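/- Let $m\ge 1$ be odd, $k\in\mathbb N_0$, $\alpha\in\mathbb R$. Let $\mathbb R_{0,m}$ be the real Clifford algebra generated by $e_1,\dots,e_m$ with $e_ie_j+e_je_i=-2\delta_{ij}$, identify $\underline x\in\mathbb R^m$ with $\sum_j x_je_j$, and let $\partial_{\underline x}=\sum_{j=1}^m e_j\partial_{x_j}$ be the Dirac operator. A $C^1$ function $F:\Omega\to\mathbb R_{0,m}$ on an open set $\Omega\subseteq\mathbb R^{m+1}$ is called monogenic if $(\partial_{x_0}+\partial_{\underline x})F=0$ in $\Omega$. Let $P_k:\mathbb R^m\to\mathbb R_{0,m}$ be a homogeneous polynomial of degree $k$ with $\partial_{\underline x}P_k=0$. For $h=u+iv$ put, with $r=|\underline x|$ and $\underline\omega=\underline x/r$ (the term with $\underline\omega$ being $0$ for $r=0$), $$\mathsf{Ft}[h(z),P_k](x_0,\underline x)=\Delta^{k+\frac{m-1}{2}}\bigl[(u(x_0,r)+\underline\omega\,v(x_0,r))P_k(\underline x)\bigr],\qquad \Delta=\sum_{j=0}^m\partial_{x_j}^2,$$ and let $$\mathsf{CK}[g](x_0,\underline x)=\sum_{n=0}^\infty\frac{(-x_0)^n}{n!}\,\partial_{\underline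 x}^n g(\underline x).$$ Let $(1+z^2)^{\beta}$ denote the principal branch, and put $$c=(-2)^{k+\frac{m-1}{2}}\,(2k+m-1)!!\prod_{j=1}^{k+\frac{m-1}{2}}(\alpha+j).$$ **Theorem.** For all $(x_0,\underline x)\in\mathbb R^{m+1}$ with $|x_0|+|\underline x|<1$ the series defining $\mathsf{CK}\bigl[(1-|\underline x|^2)^\alpha P_k\bigr](x_0,\underline x)$ converges and $$\mathsf{Ft}\Bigl[(1+z^2)^{\alpha+k+\frac{m-1}{2}},P_k\Bigr](x_0,\underline x)=c\;\mathsf{CK}\bigl[(1-|\underline x|^2)^\alpha P_k\bigr](x_0,\underline x).$$ Moreover, $\mathsf{Ft}\bigl[(1+z^2)^{\alpha+k+\frac{m-1}{2}},P_k\bigr]$ is a monogenic extension of $c\,(1-|\underline x|^2)^\alpha P_k(\underline x)$ from the unit ball $|\underline x|<1$ of $\mathbb R^m=\{x_0=0\}$ to the whole cylinder $\{(x_0,\underline x):|\underline x|<1\}$ in $\mathbb R^{m+1}$. -/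

import Mathlib

noncomputable section

namespace CliffordFueter

/-- Euclidean space `ℝ^n`. -/
abbrev E (n : ℕ) : Type := EuclideanSpace ℝ (Fin n)

/-- The quadratic form `x ↦ -∑ x_j²` on `ℝ^m`. -/
abbrev negSq (m : ℕ) : QuadraticForm ℝ (Fin m → ℝ) :=
  QuadraticMap.weightedSumSquares ℝ (fun _ : Fin m => (-1 : ℝ))

/-- The real Clifford algebra `ℝ_{0,m}`. -/
abbrev Cl (m : ℕ) : Type := CliffordAlgebra (negSq m)

/-- The embedding of vectors `x = ∑ x_j e_j` into `ℝ_{0,m}`. -/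
def vec {m : ℕ} (x : E m) : Cl m := CliffordAlgebra.ι (negSq m) x.ofLp

/-- The generators `e_1, …, e_m` (indexed from `0`). -/
def gen {m : ℕ} (j : Fin m) : Cl m := CliffordAlgebra.ι (negSq m) (Pi.single j 1)

/-- A basis of `ℝ_{0,m}` indexed by the subsets of `{1, …, m}`. -/
def basis (m : ℕ) : Module.Basis (Finset (Fin m)) ℝ (Cl m) :=
  ((Pi.basisFun ℝ (Fin m)).ExteriorAlgebra).map (CliffordAlgebra.equivExterior (negSq m)).symm

attribute [local instance] Matrix.linftyOpNormedRing Matrix.linftyOpNormedAlgebra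

/-- The finite-dimensional algebra `ℝ_{0,m}` is topologised by a norm (all norms on it are
equivalent, so derivatives, smoothness and convergence do not depend on the choice): the operator
norm of left multiplication, which is submultiplicative. -/
instance instNormedRingCl (m : ℕ) : NormedRing (Cl m) :=
  NormedRing.induced (Cl m) (Matrix (Finset (Fin m)) (Finset (Fin m)) ℝ)
    (Algebra.leftMulMatrix (basis m)) (Algebra.leftMulMatrix_injective (basis m))

instance instNormedAlgebraCl (m : ℕ) : NormedAlgebra ℝ (Cl m) :=
  NormedAlgebra.induced ℝ (Cl m) (Matrix (Finset (Fin m)) (Finset (Fin m)) ℝ)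
    (Algebra.leftMulMatrix (basis m))

/-- The Dirac operator `∑_j e_j ∂_{x_j}` on `ℝ^m`. -/
def dirac {m : ℕ} (f : E m → Cl m) (x : E m) : Cl m :=
  ∑ j : Fin m, gen j * fderiv ℝ f x (EuclideanSpace.single j 1)

/-- The vector part `x = (x_1, …, x_m)` of `X = (x_0, x_1, …, x_m) ∈ ℝ^{m+1}`; the scalar part
`x_0` is `X 0`. -/
def vpart {m : ℕ} (X : E (m + 1)) : E m := WithLp.toLp 2 (fun j : Fin m => X j.succ)

/-- The generalized Cauchy-Riemann operator `∂_{x_0} + ∑_j e_j ∂_{x_j}` on `ℝ^{m+1}`. -/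
def cauchyRiemann {m : ℕ} (f : E (m + 1) → Cl m) (X : E (m + 1)) : Cl m :=
  fderiv ℝ f X (EuclideanSpace.single 0 1) +
    ∑ j : Fin m, gen j * fderiv ℝ f X (EuclideanSpace.single j.succ 1)

/-- `f` is (left) monogenic in the open set `Ω ⊆ ℝ^{m+1}`. -/
def MonogenicOn {m : ℕ} (f : E (m + 1) → Cl m) (Ω : Set (E (m + 1))) : Prop :=
  ContDiffOn ℝ 1 f Ω ∧ ∀ X ∈ Ω, cauchyRiemann f X = 0

/-- `F` is a monogenic extension to `Ω ⊆ ℝ^{m+1}` of `g`, a function on `U ⊆ ℝ^m`, where `ℝ^m` is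
identified with the hyperplane `x_0 = 0` of `ℝ^{m+1}`. -/
def IsMonogenicExtension {m : ℕ} (g : E m → Cl m) (U : Set (E m))
    (F : E (m + 1) → Cl m) (Ω : Set (E (m + 1))) : Prop :=
  MonogenicOn F Ω ∧ ∀ X : E (m + 1), X 0 = 0 → vpart X ∈ U → X ∈ Ω ∧ F X = g (vpart X)

/-- `P : ℝ^m → ℝ_{0,m}` is a homogeneous polynomial of degree `k`: a sum of monomials
`x_1^{d_1} ⋯ x_m^{d_m}` of total degree `k` with coefficients in `ℝ_{0,m}`. -/
def IsHomogeneousPolynomial {m : ℕ} (k : ℕ) (P : E m → Cl m) : Prop :=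
  ∃ c : (Fin m → ℕ) → Cl m, ∀ x : E m,
    P x = ∑ d ∈ Finset.piAntidiag (Finset.univ : Finset (Fin m)) k, (∏ j, x j ^ d j) • c d

/-- `P` is a homogeneous monogenic polynomial of degree `k` in `ℝ^m`. -/
def IsHomogeneousMonogenic {m : ℕ} (k : ℕ) (P : E m → Cl m) : Prop :=
  IsHomogeneousPolynomial k P ∧ ∀ x, dirac P x = 0

/-- The `n`-th term `(-x_0)^n / n! · (∂^n g)(x)` of the Cauchy-Kowalevski series of `g` at
`X = (x_0, x)`, where `∂` is the Dirac operator. -/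
def ckTerm {m : ℕ} (g : E m → Cl m) (X : E (m + 1)) (n : ℕ) : Cl m :=
  ((-X 0) ^ n / (n.factorial : ℝ)) • (dirac^[n] g) (vpart X)

/-- The Cauchy-Kowalevski extension `CK[g](x_0, x) = ∑_n (-x_0)^n / n! · (∂^n g)(x)`. -/
def CK {m : ℕ} (g : E m → Cl m) (X : E (m + 1)) : Cl m := ∑' n, ckTerm g X n

/-- The function `(u(x_0, r) + ω v(x_0, r)) P(x)` on `ℝ^{m+1}`, where `h = u + i v`, `r = |x|` and
`ω = x / r`. For `r = 0` the term with `ω` is zero. -/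
def axial {m : ℕ} (h : ℂ → ℂ) (P : E m → Cl m) (X : E (m + 1)) : Cl m :=
  (algebraMap ℝ (Cl m) (h ⟨X 0, ‖vpart X‖⟩).re
    + (h ⟨X 0, ‖vpart X‖⟩).im • (‖vpart X‖⁻¹ • vec (vpart X))) * P (vpart X)

/-- The Fueter transform `Ft[h, P] = Δ^{k+(m-1)/2} [(u(x_0, r) + ω v(x_0, r)) P(x)]` (for odd `m`
and `P` of degree `k`), with `Δ` the Laplacian of `ℝ^{m+1}`. -/
def Ft {m : ℕ} (k : ℕ) (h : ℂ → ℂ) (P : E m → Cl m) : E (m + 1) → Cl m :=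
  (fun f : E (m + 1) → Cl m => Laplacian.laplacian f)^[k + (m - 1) / 2] (axial h P)

/-- The weight function `(1 - |x|²)^α P(x)`. -/
def weight {m : ℕ} (α : ℝ) (P : E m → Cl m) (x : E m) : Cl m := ((1 - ‖x‖ ^ 2) ^ α) • P x

/-- The function `h(z) = (1 + z²)^β`, principal branch. -/
def onePlusSqPow (β : ℝ) (z : ℂ) : ℂ := (1 + z ^ 2) ^ (β : ℂ)

/-- The constant `(-2)^{k+(m-1)/2} (2k+m-1)!! ∏_{j=1}^{k+(m-1)/2} (α + j)`. -/
def fueterConst (m k : ℕ) (α : ℝ) : ℝ :=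
  (-2) ^ (k + (m - 1) / 2) * (Nat.doubleFactorial (2 * k + m - 1) : ℝ) *
    ∏ j ∈ Finset.Icc 1 (k + (m - 1) / 2), (α + (j : ℝ))

end CliffordFueter

end

noncomputable section

namespace CliffordFueter

open scoped ContDiff Topology
open Filter

/-! Put N = k + (m-1)/2, so that 2k + m = 2N + 1, and use the coordinates t = x_0, s = |x|². Off the
axis x = 0 the function to be transformed is (U + x W) P with U = u and W = v/r. The Cauchy-Riemann
equations for h become U_t = W + 2s W_s, W_t = -2 U_s (`VekuaPair`). Differentiating n times in s
keeps this shape, with 2n + 1 in front of W (`VekuaPair.iterate`).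

Factor the Laplacian as the conjugate Cauchy-Riemann operator applied to the Cauchy-Riemann operator
(`laplacian_eq_conjCauchyRiemann`). On the pair of n-th s-derivatives the inner operator leaves only
2(n - N) (∂_s^n W) P, and the outer one turns this into a multiple of the next pair
(`cauchyRiemann_radialPair`, `laplacian_radialPair`). Hence Δ^N gives the N-th pair times ∏ 4(N - i)
= 2^N (2N)!!, and the factor n - N makes the N-th pair monogenic.

On x_0 = 0 the function (1 + z²)^β is real, so W and all its s-derivatives vanish there, while U =
(1 - s)^β. Its N-th derivative produces the remaining factors of c and the exponent β - N = α
(`Ft_join_zero`). Since h has real Taylor coefficients at real points, everything is real analytic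
across the axis, and the identities extend there by continuity.

Monogenicity turns ∂_{x_0} into minus the Dirac operator, so the Taylor coefficients in x_0 are
those of c times the CK series (`iteratedDeriv_join_eq_dirac`). Convergence comes from an explicit
recursion for the iterated Dirac operator on power series in |x|², dominated by binomial expansions
of (|x_0| + ρ)^{2J+2N} (`abs_diracCoeff_le`, `summable_choose_mul_pow`). The identity theorem in x_0
then identifies the sum (`hasSum_taylor_of_summable`). -/

instance instFiniteDimensionalCl (m : ℕ) : FiniteDimensional ℝ (Cl m) :=
  (basis m).finiteDimensional_of_finite

instance instCompleteSpaceCl (m : ℕ) : CompleteSpace (Cl m) := FiniteDimensional.complete ℝ (Cl m)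

/-! ### Clifford algebra identities. -/

/-- The embedding `vec` as a continuous linear map. -/
def vecL (m : ℕ) : E m →L[ℝ] Cl m :=
  LinearMap.toContinuousLinearMap
    ((CliffordAlgebra.ι (negSq m)) ∘ₗ (WithLp.linearEquiv 2 ℝ (Fin m → ℝ)).toLinearMap)

variable {m : ℕ}

theorem vecL_apply (x : E m) : vecL m x = vec x := rfl

theorem vec_single (j : Fin m) : vec (EuclideanSpace.single j (1 : ℝ)) = gen j := rfl

theorem negSq_apply (x : E m) : negSq m x.ofLp = -‖x‖ ^ 2 := by
  rw [QuadraticMap.weightedSumSquares_apply, EuclideanSpace.norm_sq_eq]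
  simp [pow_two]

theorem vec_mul_vec (x : E m) : vec x * vec x = algebraMap ℝ (Cl m) (-‖x‖ ^ 2) := by
  rw [vec, CliffordAlgebra.ι_sq_scalar, negSq_apply]

theorem vec_mul_vec_mul (x : E m) (a : Cl m) : vec x * (vec x * a) = (-‖x‖ ^ 2) • a := by
  rw [← mul_assoc, vec_mul_vec, Algebra.smul_def]

/-- Polarisation of y² = -|y|² at y = e_j + x. -/
theorem gen_mul_vec (j : Fin m) (x : E m) :
    gen j * vec x = algebraMap ℝ (Cl m) (-2 * x j) - vec x * gen j := by
  have key : ∀ y : E m, vec y * vec y = algebraMap ℝ (Cl m) (-‖y‖ ^ 2) := vec_mul_vec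
  have hadd : vec (EuclideanSpace.single j (1 : ℝ) + x) = gen j + vec x := by
    rw [← vecL_apply, map_add]; rfl
  have h1 := key (EuclideanSpace.single j (1 : ℝ) + x)
  rw [hadd] at h1
  have h2 : gen j * gen j = algebraMap ℝ (Cl m) (-1) := by
    have := key (EuclideanSpace.single j (1 : ℝ)); rw [vec_single] at this; simpa using this
  have h3 := key x
  have hn : ‖EuclideanSpace.single j (1 : ℝ) + x‖ ^ 2 = 1 + 2 * x j + ‖x‖ ^ 2 := by
    rw [norm_add_sq_real, EuclideanSpace.inner_single_left]; simp
  rw [hn] at h1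
  have h4 : gen j * vec x + vec x * gen j
      = (gen j + vec x) * (gen j + vec x) - gen j * gen j - vec x * vec x := by noncomm_ring
  rw [eq_sub_iff_add_eq, h4, h1, h2, h3, ← map_sub, ← map_sub]
  congr 1; ring

theorem gen_mul_gen_add (i j : Fin m) :
    gen i * gen j + gen j * gen i = algebraMap ℝ (Cl m) (if i = j then -2 else 0) := by
  have := gen_mul_vec i (EuclideanSpace.single j (1 : ℝ))
  rw [vec_single] at this
  rw [this, sub_add_cancel]
  congr 1
  by_cases h : i = j <;> simp [h]

theorem sum_smul_gen (x : E m) : ∑ j, x j • gen j = vec x := by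
  conv_rhs => rw [← (EuclideanSpace.basisFun (Fin m) ℝ).sum_repr x, ← vecL_apply, map_sum]
  refine Finset.sum_congr rfl fun j _ => ?_
  rw [map_smul]
  simp [vecL_apply, vec_single]

theorem sum_gen_mul_gen (a : Cl m) : ∑ j : Fin m, gen j * (gen j * a) = (-(m : ℝ)) • a := by
  have (j : Fin m) : gen j * (gen j * a) = (-1 : ℝ) • a := by
    rw [← vec_single, vec_mul_vec_mul]; simp
  simp_rw [this]
  simp [← Nat.cast_smul_eq_nsmul ℝ]

/-! ### First-order formulas for the Dirac operator -/

theorem dirac_congr {f g : E m → Cl m} {x : E m} (h : f =ᶠ[𝓝 x] g) : dirac f x = dirac g x := by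
  simp only [dirac, h.fderiv_eq]

theorem sum_gen_mul_inner (x : E m) (a : Cl m) :
    ∑ j, gen j * (x j • a) = vec x * a := by
  rw [← sum_smul_gen x, Finset.sum_mul]
  simp

theorem dirac_radial_smul {φ : ℝ → ℝ} {φ' : ℝ} {Q : E m → Cl m} {x : E m}
    (hφ : HasDerivAt φ φ' (‖x‖ ^ 2)) (hQ : DifferentiableAt ℝ Q x) :
    dirac (fun y => φ (‖y‖ ^ 2) • Q y) x = (2 * φ') • (vec x * Q x) + φ (‖x‖ ^ 2) • dirac Q x := by
  have h1 : HasFDerivAt (fun y : E m => φ (‖y‖ ^ 2)) (φ' • (2 • innerSL ℝ x)) x :=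
    hφ.comp_hasFDerivAt x (HasStrictFDerivAt.hasFDerivAt (hasStrictFDerivAt_norm_sq x))
  have h2 := (h1.smul hQ.hasFDerivAt).fderiv
  have h3 : fderiv ℝ (fun y => φ (‖y‖ ^ 2) • Q y) x = _ := h2
  simp only [dirac, h3]
  rw [← sum_gen_mul_inner, Finset.smul_sum, Finset.smul_sum, ← Finset.sum_add_distrib]
  refine Finset.sum_congr rfl fun j _ => ?_
  have : inner ℝ x (EuclideanSpace.single j (1 : ℝ)) = x j := by
    rw [EuclideanSpace.inner_single_right]; simp
  simp [this, mul_add, smul_smul]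
  rw [add_comm]
  congr 2
  ring

/-! ### Homogeneous polynomials -/

theorem IsHomogeneousPolynomial.contDiff {k : ℕ} {P : E m → Cl m}
    (hP : IsHomogeneousPolynomial k P) : ContDiff ℝ ω P := by
  obtain ⟨c, hc⟩ := hP
  rw [funext hc]
  refine ContDiff.sum fun d _ => ContDiff.fun_smul (contDiff_prod fun j _ => ?_) contDiff_const
  exact ContDiff.pow (EuclideanSpace.proj (𝕜 := ℝ) j).contDiff _

theorem IsHomogeneousPolynomial.smul {k : ℕ} {P : E m → Cl m}
    (hP : IsHomogeneousPolynomial k P) (t : ℝ) (x : E m) : P (t • x) = t ^ k • P x := by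
  obtain ⟨c, hc⟩ := hP
  rw [hc, hc, Finset.smul_sum]
  refine Finset.sum_congr rfl fun d hd => ?_
  rw [Finset.mem_piAntidiag] at hd
  rw [smul_smul, ← hd.1, ← Finset.prod_pow_eq_pow_sum, ← Finset.prod_mul_distrib]
  simp [mul_pow]

theorem IsHomogeneousPolynomial.euler {k : ℕ} {P : E m → Cl m}
    (hP : IsHomogeneousPolynomial k P) (x : E m) : fderiv ℝ P x x = (k : ℝ) • P x := by
  have hd : DifferentiableAt ℝ P x := hP.contDiff.differentiable (by simp) x
  have h1 : HasDerivAt (fun t : ℝ => P (t • x)) (fderiv ℝ P x x) 1 := by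
    have hl : HasDerivAt (fun t : ℝ => t • x) x 1 := by
      simpa using (hasDerivAt_id (1 : ℝ)).smul_const x
    have hd' : HasFDerivAt P (fderiv ℝ P x) ((1 : ℝ) • x) := by
      rw [one_smul]; exact hd.hasFDerivAt
    exact hd'.comp_hasDerivAt 1 hl
  have h2 : HasDerivAt (fun t : ℝ => P (t • x)) ((k : ℝ) • P x) 1 := by
    simp_rw [hP.smul]
    simpa using (hasDerivAt_pow k (1 : ℝ)).smul_const (P x)
  exact h1.unique h2

/-- Moving e_j past x produces -2 x_j ∂_j P, whose sum is -2k P by Euler, and a term -x ∂P = 0.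
Differentiating the factor x itself contributes ∑ e_j² P = -m P. -/
theorem IsHomogeneousMonogenic.dirac_vec_mul {k : ℕ} {P : E m → Cl m}
    (hP : IsHomogeneousMonogenic k P) (x : E m) :
    dirac (fun y => vec y * P y) x = (-(2 * k + m : ℝ)) • P x := by
  have hd : DifferentiableAt ℝ P x := hP.1.contDiff.differentiable (by simp) x
  have h1 : fderiv ℝ (fun y => vec y * P y) x = _ :=
    ((vecL m).hasFDerivAt.mul' hd.hasFDerivAt).fderiv
  have h2 (j : Fin m) : gen j * fderiv ℝ (fun y => vec y * P y) x (EuclideanSpace.single j 1)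
      = (-2 : ℝ) • fderiv ℝ P x (x j • EuclideanSpace.single j 1)
        - vec x * (gen j * fderiv ℝ P x (EuclideanSpace.single j 1)) + gen j * (gen j * P x) := by
    rw [h1]
    have : gen j * (vec x * fderiv ℝ P x (EuclideanSpace.single j 1)) =
        (-2 : ℝ) • fderiv ℝ P x (x j • EuclideanSpace.single j 1)
        - vec x * (gen j * fderiv ℝ P x (EuclideanSpace.single j 1)) := by
      rw [← mul_assoc, gen_mul_vec, sub_mul, ← Algebra.smul_def, map_smul, smul_smul, mul_assoc]
    simp only [add_apply, smul_apply, vecL_apply, vec_single, smul_eq_mul, mul_add,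
      MulOpposite.smul_eq_mul_unop, MulOpposite.unop_op, this]
  rw [dirac, Finset.sum_congr rfl fun j _ => h2 j, Finset.sum_add_distrib, Finset.sum_sub_distrib,
    ← Finset.smul_sum, ← map_sum, ← Finset.mul_sum, sum_gen_mul_gen]
  have h3 : ∑ j, x j • EuclideanSpace.single j (1 : ℝ) = x := by
    simpa using (EuclideanSpace.basisFun (Fin m) ℝ).sum_repr x
  have h4 : ∑ j, gen j * fderiv ℝ P x (EuclideanSpace.single j 1) = 0 := hP.2 x
  rw [h3, h4, hP.1.euler, mul_zero, smul_smul, sub_zero, ← add_smul]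
  congr 1; ring

/-! ### Coordinates on ℝ^{m+1}. -/

/-- The vector part as a continuous linear map. -/
def vpartL (m : ℕ) : E (m + 1) →L[ℝ] E m :=
  LinearMap.toContinuousLinearMap
    { toFun := vpart
      map_add' := fun _ _ => rfl
      map_smul' := fun _ _ => rfl }

theorem vpartL_apply (X : E (m + 1)) : vpartL m X = vpart X := rfl

/-- The scalar part as a continuous linear map. -/
def spartL (m : ℕ) : E (m + 1) →L[ℝ] ℝ := EuclideanSpace.proj (𝕜 := ℝ) 0

theorem spartL_apply (X : E (m + 1)) : spartL m X = X 0 := rfl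

@[simp] theorem vpart_single_zero : vpart (EuclideanSpace.single (0 : Fin (m + 1)) (1 : ℝ)) = 0 := by
  ext j; simp [vpart]

@[simp] theorem vpart_single_succ (j : Fin m) :
    vpart (EuclideanSpace.single j.succ (1 : ℝ)) = EuclideanSpace.single j 1 := by
  ext i; simp [vpart]

/-- The point `(t, x)` of `ℝ^{m+1}`. -/
def join (t : ℝ) (x : E m) : E (m + 1) := WithLp.toLp 2 (Fin.cons t x.ofLp)

@[simp] theorem join_zero (t : ℝ) (x : E m) : join t x 0 = t := rfl

@[simp] theorem vpart_join (t : ℝ) (x : E m) : vpart (join t x) = x := rfl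

theorem join_self (X : E (m + 1)) : join (X 0) (vpart X) = X := by
  ext i; refine Fin.cases rfl (fun j => rfl) i

/-- The embedding of the hyperplane `x_0 = 0` as a continuous linear map. -/
def joinL (m : ℕ) : E m →L[ℝ] E (m + 1) :=
  LinearMap.toContinuousLinearMap
    { toFun := join 0
      map_add' := fun x y => by
        ext i; refine Fin.cases ?_ (fun j => rfl) i; simp [join]
      map_smul' := fun c x => by
        ext i; refine Fin.cases ?_ (fun j => rfl) i; simp [join] }

theorem joinL_apply (x : E m) : joinL m x = join 0 x := rfl

theorem joinL_single (j : Fin m) :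
    joinL m (EuclideanSpace.single j 1) = EuclideanSpace.single j.succ 1 := by
  ext i; refine Fin.cases ?_ (fun j => ?_) i <;> simp [joinL_apply, join, Pi.single_apply]

theorem join_eq (t : ℝ) (x : E m) :
    join t x = t • EuclideanSpace.single 0 1 + joinL m x := by
  ext i; refine Fin.cases ?_ (fun j => ?_) i <;> simp [joinL_apply, join]

/-! ### Cauchy-Riemann operators and the factorisation of the Laplacian. -/

/-- The conjugate Cauchy-Riemann operator `∂_{x_0} - ∑_j e_j ∂_{x_j}`. -/
def conjCauchyRiemann (f : E (m + 1) → Cl m) (X : E (m + 1)) : Cl m :=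
  fderiv ℝ f X (EuclideanSpace.single 0 1) -
    ∑ j : Fin m, gen j * fderiv ℝ f X (EuclideanSpace.single j.succ 1)

theorem cauchyRiemann_congr {f g : E (m + 1) → Cl m} {X : E (m + 1)} (h : f =ᶠ[𝓝 X] g) :
    cauchyRiemann f X = cauchyRiemann g X := by
  simp only [cauchyRiemann, h.fderiv_eq]

theorem conjCauchyRiemann_congr {f g : E (m + 1) → Cl m} {X : E (m + 1)} (h : f =ᶠ[𝓝 X] g) :
    conjCauchyRiemann f X = conjCauchyRiemann g X := by
  simp only [conjCauchyRiemann, h.fderiv_eq]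

theorem fderiv_fderiv_apply_eq {n : ℕ} {f : E n → Cl m} {X : E n} (hf : ContDiffAt ℝ ω f X)
    (v w : E n) : fderiv ℝ (fun Y => fderiv ℝ f Y w) X v = fderiv ℝ (fderiv ℝ f) X v w := by
  have h : DifferentiableAt ℝ (fderiv ℝ f) X :=
    (hf.fderiv_right (m := ω) le_rfl).differentiableAt (by simp)
  rw [(h.hasFDerivAt.clm_apply (hasFDerivAt_const w X)).fderiv]
  simp

theorem fderiv_cauchyRiemann {f : E (m + 1) → Cl m} {X : E (m + 1)} (hf : ContDiffAt ℝ ω f X)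
    (v : E (m + 1)) : fderiv ℝ (cauchyRiemann f) X v =
      fderiv ℝ (fderiv ℝ f) X v (EuclideanSpace.single 0 1) +
        ∑ j : Fin m, gen j * fderiv ℝ (fderiv ℝ f) X v (EuclideanSpace.single j.succ 1) := by
  have h : DifferentiableAt ℝ (fderiv ℝ f) X :=
    (hf.fderiv_right (m := ω) le_rfl).differentiableAt (by simp)
  have h0 (w : E (m + 1)) := h.hasFDerivAt.clm_apply (hasFDerivAt_const w X)
  have h1 : HasFDerivAt (cauchyRiemann f) _ X :=
    (h0 (EuclideanSpace.single 0 1)).add (HasFDerivAt.fun_sum (u := Finset.univ) fun (j : Fin m) _ =>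
      (h0 (EuclideanSpace.single j.succ 1)).const_mul (gen j))
  rw [h1.fderiv]
  simp

/-- Second derivatives are symmetric: the mixed terms in x_0 and x_j cancel, and averaging the
double sum over e_i e_j with its transpose leaves only the diagonal e_i² = -1. -/
theorem laplacian_eq_conjCauchyRiemann {f : E (m + 1) → Cl m} {X : E (m + 1)}
    (hf : ContDiffAt ℝ ω f X) :
    Laplacian.laplacian f X = conjCauchyRiemann (cauchyRiemann f) X := by
  have hsymm : IsSymmSndFDerivAt ℝ f X := hf.isSymmSndFDerivAt_of_omega
  rw [InnerProductSpace.laplacian_eq_iteratedFDeriv_orthonormalBasis f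
    (EuclideanSpace.basisFun (Fin (m + 1)) ℝ), conjCauchyRiemann]
  simp only [fderiv_cauchyRiemann hf, iteratedFDeriv_two_apply, Fin.sum_univ_succ,
    EuclideanSpace.basisFun_apply, Matrix.cons_val_zero, Matrix.cons_val_one]
  set B := fderiv ℝ (fderiv ℝ f) X
  have hB : ∀ v w, B v w = B w v := hsymm
  set e : Fin m → E (m + 1) := fun j => EuclideanSpace.single j.succ 1
  have key : ∑ i, ∑ j, gen i * (gen j * B (e i) (e j)) = -∑ i, B (e i) (e i) := by
    have h2 : ∑ i, ∑ j, gen i * (gen j * B (e i) (e j)) =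
        ∑ i, ∑ j, gen j * (gen i * B (e i) (e j)) := by
      rw [Finset.sum_comm]
      exact Finset.sum_congr rfl fun i _ => Finset.sum_congr rfl fun j _ => by rw [hB]
    have h3 : (2 : ℝ) • ∑ i, ∑ j, gen i * (gen j * B (e i) (e j))
        = (2 : ℝ) • -∑ i, B (e i) (e i) := by
      rw [two_smul]
      nth_rewrite 2 [h2]
      simp_rw [← Finset.sum_add_distrib, ← mul_assoc, ← add_mul, gen_mul_gen_add,
        ← Algebra.smul_def, ite_smul, zero_smul, Finset.sum_ite_eq, Finset.mem_univ, if_true]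
      rw [← Finset.smul_sum, smul_neg, ← neg_smul]
    exact smul_right_injective _ (two_ne_zero (α := ℝ)) h3
  simp_rw [mul_add, Finset.sum_add_distrib, Finset.mul_sum]
  set e0 : E (m + 1) := EuclideanSpace.single 0 1
  have h0 : ∑ j, gen j * B e0 (e j) = ∑ j, gen j * B (e j) e0 :=
    Finset.sum_congr rfl fun j _ => by rw [hB]
  change B e0 e0 + ∑ i, B (e i) (e i) = B e0 e0 + ∑ j, gen j * B e0 (e j) -
    (∑ j, gen j * B (e j) e0 + ∑ i, ∑ j, gen i * (gen j * B (e i) (e j)))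
  rw [h0, key]
  abel

/-! ### First-order operators on functions A(x_0, |x|²) Q(x). -/

theorem fderiv_radial_smul {A : ℝ × ℝ → ℝ} {A' : ℝ × ℝ →L[ℝ] ℝ} {Q : E m → Cl m}
    {X : E (m + 1)} (hA : HasFDerivAt A A' (X 0, ‖vpart X‖ ^ 2))
    (hQ : DifferentiableAt ℝ Q (vpart X)) (v : E (m + 1)) :
    fderiv ℝ (fun Y : E (m + 1) => A (Y 0, ‖vpart Y‖ ^ 2) • Q (vpart Y)) X v =
      (A' (v 0, 2 * inner ℝ (vpart X) (vpart v))) • Q (vpart X) +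
        A (X 0, ‖vpart X‖ ^ 2) • fderiv ℝ Q (vpart X) (vpart v) := by
  have h1 : HasFDerivAt (fun Y : E (m + 1) => (Y 0, ‖vpart Y‖ ^ 2))
      ((spartL m).prod ((2 • innerSL ℝ (vpart X)).comp (vpartL m))) X :=
    (spartL m).hasFDerivAt.prodMk
      (((hasStrictFDerivAt_norm_sq (vpart X)).hasFDerivAt).comp X (vpartL m).hasFDerivAt)
  have h2 : HasFDerivAt (fun Y : E (m + 1) => Q (vpart Y))
      ((fderiv ℝ Q (vpart X)).comp (vpartL m)) X :=
    HasFDerivAt.comp (g := Q) X hQ.hasFDerivAt (vpartL m).hasFDerivAt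
  have h3 := ((HasFDerivAt.comp X hA h1).smul h2).fderiv
  have h4 : fderiv ℝ (fun Y : E (m + 1) => A (Y 0, ‖vpart Y‖ ^ 2) • Q (vpart Y)) X = _ := h3
  rw [h4]
  simp [vpartL_apply, spartL_apply]
  abel

theorem sum_gen_mul_fderiv_radial_smul {A : ℝ × ℝ → ℝ} {A' : ℝ × ℝ →L[ℝ] ℝ} {Q : E m → Cl m}
    {X : E (m + 1)} (hA : HasFDerivAt A A' (X 0, ‖vpart X‖ ^ 2))
    (hQ : DifferentiableAt ℝ Q (vpart X)) :
    ∑ j : Fin m, gen j * fderiv ℝ (fun Y : E (m + 1) => A (Y 0, ‖vpart Y‖ ^ 2) • Q (vpart Y)) X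
        (EuclideanSpace.single j.succ 1) =
      (2 * A' (0, 1)) • (vec (vpart X) * Q (vpart X)) +
        A (X 0, ‖vpart X‖ ^ 2) • dirac Q (vpart X) := by
  simp only [fderiv_radial_smul hA hQ]
  rw [← sum_gen_mul_inner, dirac, Finset.smul_sum, Finset.smul_sum, ← Finset.sum_add_distrib]
  refine Finset.sum_congr rfl fun j _ => ?_
  have h1 : A' (0, 2 * vpart X j) = 2 * vpart X j * A' (0, 1) := by
    have : ((0 : ℝ), 2 * vpart X j) = (2 * vpart X j) • ((0 : ℝ), (1 : ℝ)) := by simp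
    rw [this, map_smul, smul_eq_mul]
  have h2 : inner ℝ (vpart X) (EuclideanSpace.single j (1 : ℝ)) = vpart X j := by
    rw [EuclideanSpace.inner_single_right]; simp
  simp only [vpart_single_succ, h2, mul_add, mul_smul_comm, smul_smul]
  simp only [PiLp.single_apply, h1, (Fin.succ_ne_zero j).symm, if_false]
  congr 2
  ring

theorem cauchyRiemann_radial_smul {A : ℝ × ℝ → ℝ} {A' : ℝ × ℝ →L[ℝ] ℝ} {Q : E m → Cl m}
    {X : E (m + 1)} (hA : HasFDerivAt A A' (X 0, ‖vpart X‖ ^ 2))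
    (hQ : DifferentiableAt ℝ Q (vpart X)) :
    cauchyRiemann (fun Y : E (m + 1) => A (Y 0, ‖vpart Y‖ ^ 2) • Q (vpart Y)) X =
      A' (1, 0) • Q (vpart X) + ((2 * A' (0, 1)) • (vec (vpart X) * Q (vpart X)) +
        A (X 0, ‖vpart X‖ ^ 2) • dirac Q (vpart X)) := by
  rw [cauchyRiemann, sum_gen_mul_fderiv_radial_smul hA hQ, fderiv_radial_smul hA hQ]
  simp

theorem conjCauchyRiemann_radial_smul {A : ℝ × ℝ → ℝ} {A' : ℝ × ℝ →L[ℝ] ℝ} {Q : E m → Cl m}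
    {X : E (m + 1)} (hA : HasFDerivAt A A' (X 0, ‖vpart X‖ ^ 2))
    (hQ : DifferentiableAt ℝ Q (vpart X)) :
    conjCauchyRiemann (fun Y : E (m + 1) => A (Y 0, ‖vpart Y‖ ^ 2) • Q (vpart Y)) X =
      A' (1, 0) • Q (vpart X) - ((2 * A' (0, 1)) • (vec (vpart X) * Q (vpart X)) +
        A (X 0, ‖vpart X‖ ^ 2) • dirac Q (vpart X)) := by
  rw [conjCauchyRiemann, sum_gen_mul_fderiv_radial_smul hA hQ, fderiv_radial_smul hA hQ]
  simp

theorem cauchyRiemann_add {f g : E (m + 1) → Cl m} {X : E (m + 1)}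
    (hf : DifferentiableAt ℝ f X) (hg : DifferentiableAt ℝ g X) :
    cauchyRiemann (fun Y => f Y + g Y) X = cauchyRiemann f X + cauchyRiemann g X := by
  simp only [cauchyRiemann, fderiv_fun_add hf hg, add_apply, mul_add,
    Finset.sum_add_distrib]
  abel

/-! ### Real analyticity of axial functions, including on the axis. -/

/-- A holomorphic function that is real on the real axis near `a` has a power series expansion at
`a` with real coefficients. -/
theorem exists_real_powerSeries {h : ℂ → ℂ} {a : ℝ} (hh : AnalyticAt ℂ h a)
    (hr : ∀ᶠ x : ℝ in 𝓝 a, (h x).im = 0) :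
    ∃ c : ℕ → ℝ, ∃ ε > 0, Summable (fun n => |c n| * ε ^ n) ∧
      ∀ᶠ z : ℂ in 𝓝 0, HasSum (fun n => c n • z ^ n) (h (a + z)) := by
  obtain ⟨p, hp⟩ := hh
  set c : ℕ → ℝ := fun n => (p.coeff n).re with hc
  have hcp (n : ℕ) : |c n| ≤ ‖p n‖ := by
    exact (Complex.abs_re_le_norm _).trans (p.norm_apply_eq_norm_coef).ge
  obtain ⟨ε, hε0, hε⟩ := ENNReal.lt_iff_exists_nnreal_btwn.1 hp.radius_pos
  have hε0' : 0 < (ε : ℝ) := by exact_mod_cast hε0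
  have hsum : Summable (fun n => |c n| * (ε : ℝ) ^ n) :=
    Summable.of_nonneg_of_le (fun n => by positivity)
      (fun n => mul_le_mul_of_nonneg_right (hcp n) (by positivity)) (p.summable_norm_mul_pow hε)
  refine ⟨c, ε, hε0', hsum, ?_⟩
  set q := FormalMultilinearSeries.ofScalars ℂ (fun n => (c n : ℂ)) with hq
  have hqr : 0 < q.radius := by
    refine lt_of_lt_of_le hp.radius_pos (FormalMultilinearSeries.radius_le_of_le fun n => ?_)
    rw [hq, FormalMultilinearSeries.ofScalars_norm]
    simpa using hcp n
  have hqs := q.hasFPowerSeriesOnBall hqr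
  have hh0 : HasFPowerSeriesAt (fun z : ℂ => h (a + z)) p 0 := by
    rw [hasFPowerSeriesAt_iff] at hp ⊢
    simpa using hp
  -- By the identity theorem it is enough to compare at real points. There h is real, so it equals
  -- the sum of the real parts of its Taylor terms.
  have hev : ∀ᶠ z : ℂ in 𝓝 0, h (a + z) = q.sum z := by
    refine (AnalyticAt.frequently_eq_iff_eventually_eq hh0.analyticAt
      hqs.analyticAt).1 ?_
    have ht : Tendsto (fun x : ℝ => (x : ℂ)) (𝓝 0) (𝓝 0) := by
      simpa using Complex.continuous_ofReal.tendsto 0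
    have ht' : Tendsto (fun x : ℝ => (x : ℂ)) (𝓝[≠] 0) (𝓝[≠] 0) :=
      ht.inf (tendsto_principal_principal.2 fun x hx => by simpa using hx)
    refine ht'.frequently (Eventually.frequently ?_)
    refine Eventually.filter_mono nhdsWithin_le_nhds ?_
    have h1 := ht.eventually (hasFPowerSeriesAt_iff.1 hh0)
    have h2 := ht.eventually (hqs.hasFPowerSeriesAt.eventually_hasSum)
    have h3 : ∀ᶠ x : ℝ in 𝓝 0, (h (a + x : ℝ)).im = 0 := by
      have : Tendsto (fun x : ℝ => a + x) (𝓝 0) (𝓝 a) := by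
        simpa using (continuous_const_add a).tendsto (0 : ℝ)
      exact this.eventually hr
    filter_upwards [h1, h2, h3] with x h1 h2 h3
    have h4 : HasSum (fun n => x ^ n * c n) (h (a + x)).re := by
      have := Complex.hasSum_re h1
      simp only [zero_add, smul_eq_mul, ← Complex.ofReal_pow, Complex.re_ofReal_mul] at this
      exact this
    have h5 : HasSum (fun n => ((x ^ n * c n : ℝ) : ℂ)) (q.sum x) := by
      simp only [zero_add] at h2
      have e : (fun n => ((x ^ n * c n : ℝ) : ℂ)) = fun n => q n fun _ => (x : ℂ) := by
        funext n
        rw [hq, FormalMultilinearSeries.ofScalars_apply_eq]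
        simp [mul_comm]
      rw [e]; exact h2
    have h6 : HasSum (fun n => ((x ^ n * c n : ℝ) : ℂ)) (((h (a + x)).re : ℝ) : ℂ) :=
      Complex.hasSum_ofReal.2 h4
    rw [h5.unique h6]
    push_cast at h3
    apply Complex.ext <;> simp [h3]
  filter_upwards [hev, hqs.hasFPowerSeriesAt.eventually_hasSum] with z h1 h2
  rw [h1]
  simp only [zero_add] at h2
  have e : (fun n => c n • z ^ n) = fun n => q n fun _ => z := by
    funext n
    rw [hq, FormalMultilinearSeries.ofScalars_apply_eq]
    simp
  rw [e]; exact h2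

/-- A power series expansion of `w = h(t + i|x|)` with real coefficients gives one of `u + ω v` in the
paravector `t + x`. -/
theorem hasSum_axial {c : ℕ → ℝ} {t : ℝ} {x : E m} {w : ℂ}
    (hs : HasSum (fun n => c n • (⟨t, ‖x‖⟩ : ℂ) ^ n) w) :
    HasSum (fun n => c n • (algebraMap ℝ (Cl m) t + vec x) ^ n)
      (algebraMap ℝ (Cl m) w.re + w.im • (‖x‖⁻¹ • vec x)) := by
  by_cases hx : x = 0
  · subst hx
    have hv : vec (0 : E m) = 0 := (vecL m).map_zero
    have hz : (⟨t, ‖(0 : E m)‖⟩ : ℂ) = (t : ℂ) := by apply Complex.ext <;> simp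
    rw [hz] at hs
    have h1 : HasSum (fun n => c n * t ^ n) w.re := by
      have := Complex.hasSum_re hs
      simpa only [Complex.smul_re, ← Complex.ofReal_pow, Complex.ofReal_re, smul_eq_mul] using this
    have h2 := h1.mapL (Algebra.linearMap ℝ (Cl m)).toContinuousLinearMap
    have e : (fun n => c n • (algebraMap ℝ (Cl m) t + vec (0 : E m)) ^ n) =
        fun n => (Algebra.linearMap ℝ (Cl m)).toContinuousLinearMap (c n * t ^ n) := by
      funext n
      simp [hv, Algebra.smul_def]
    rw [e, hv, smul_zero, smul_zero, add_zero]
    exact h2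
  · have hx' : ‖x‖ ≠ 0 := norm_ne_zero_iff.2 hx
    have hI : (‖x‖⁻¹ • vec x) * (‖x‖⁻¹ • vec x) = -1 := by
      rw [smul_mul_smul_comm, vec_mul_vec, Algebra.smul_def, ← map_mul]
      have : ‖x‖⁻¹ * ‖x‖⁻¹ * -‖x‖ ^ 2 = -1 := by field_simp
      rw [this, map_neg, map_one]
    -- As ω² = -1, the map i ↦ ω is an algebra homomorphism from ℂ; it carries the series in t +
    -- i|x| to the one in t + x.
    set L := Complex.liftAux (‖x‖⁻¹ • vec x) hI
    have h2 := hs.mapL L.toLinearMap.toContinuousLinearMap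
    have hL (z : ℂ) : L z = algebraMap ℝ (Cl m) z.re + z.im • (‖x‖⁻¹ • vec x) :=
      Complex.liftAux_apply _ hI z
    have hL1 : L ⟨t, ‖x‖⟩ = algebraMap ℝ (Cl m) t + vec x := by
      rw [hL]; simp [smul_smul, hx']
    have e : (fun n => c n • (algebraMap ℝ (Cl m) t + vec x) ^ n) =
        fun n => L.toLinearMap.toContinuousLinearMap (c n • (⟨t, ‖x‖⟩ : ℂ) ^ n) := by
      funext n
      rw [← hL1, map_smul, ← map_pow]
      rfl
    rw [e, ← hL]
    exact h2

/-- Although ω and r are singular on the axis, u + ω v is there a power series with real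
coefficients in the paravector (x_0 - a) + x, which depends analytically on the point. -/
theorem contDiffAt_axial_of_vpart_eq_zero {h : ℂ → ℂ} {P : E m → Cl m} {X : E (m + 1)}
    (hX : vpart X = 0) (hh : AnalyticAt ℂ h (X 0)) (hr : ∀ᶠ x : ℝ in 𝓝 (X 0), (h x).im = 0)
    (hP : ContDiffAt ℝ ω P (vpart X)) : ContDiffAt ℝ ω (axial h P) X := by
  obtain ⟨c, ε, hε, hc, hs⟩ := exists_real_powerSeries hh hr
  set q := FormalMultilinearSeries.ofScalars (Cl m) c with hq
  have hqr : 0 < q.radius := by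
    lift ε to NNReal using hε.le
    refine lt_of_lt_of_le (b := (ε : ENNReal)) (by exact_mod_cast hε) ?_
    obtain ⟨C, hC⟩ := hc.tendsto_atTop_zero.bddAbove_range
    refine q.le_radius_of_bound (max C ‖q 0‖) fun n => ?_
    rcases Nat.eq_zero_or_pos n with rfl | hn
    · simp
    · refine le_max_of_le_left (le_trans ?_ (hC ⟨n, rfl⟩))
      exact mul_le_mul_of_nonneg_right (FormalMultilinearSeries.ofScalars_norm_le _ c n hn)
        (by positivity)
  have hqs := q.hasFPowerSeriesOnBall hqr
  let y : E (m + 1) → Cl m := fun Y => algebraMap ℝ (Cl m) (Y 0 - X 0) + vec (vpart Y)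
  have hy : ContDiff ℝ ω y := by
    have h1 : ContDiff ℝ ω fun Y : E (m + 1) => algebraMap ℝ (Cl m) (Y 0 - X 0) :=
      (Algebra.linearMap ℝ (Cl m)).toContinuousLinearMap.contDiff.comp
        ((spartL m).contDiff.sub contDiff_const)
    exact h1.add ((vecL m).contDiff.comp (vpartL m).contDiff)
  have hy0 : y X = 0 := by
    simp only [y, hX, sub_self, map_zero, zero_add]
    exact (vecL m).map_zero
  have hq0 : ContDiffAt ℝ ω q.sum (y X) := by
    rw [hy0]; exact hqs.analyticAt.contDiffAt
  have hmain : ContDiffAt ℝ ω (fun Y => q.sum (y Y) * P (vpart Y)) X :=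
    (hq0.comp X hy.contDiffAt).mul (hP.comp X (vpartL m).contDiff.contDiffAt)
  refine hmain.congr_of_eventuallyEq ?_
  have hz : Tendsto (fun Y : E (m + 1) => (⟨Y 0 - X 0, ‖vpart Y‖⟩ : ℂ)) (𝓝 X) (𝓝 0) := by
    have h1 : Continuous fun Y : E (m + 1) => ((Y 0 - X 0 : ℝ) : ℂ) + (‖vpart Y‖ : ℝ) * Complex.I :=
      (Complex.continuous_ofReal.comp ((spartL m).continuous.sub continuous_const)).add
        ((Complex.continuous_ofReal.comp (vpartL m).continuous.norm).mul continuous_const)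
    have h2 := h1.tendsto X
    simp only [sub_self, hX, norm_zero, Complex.ofReal_zero, zero_mul, add_zero] at h2
    refine h2.congr fun Y => ?_
    rw [Complex.mk_eq_add_mul_I]
  have hyt : Tendsto y (𝓝 X) (𝓝 0) := by
    have := hy.continuous.tendsto X; rwa [hy0] at this
  filter_upwards [hz.eventually hs, hyt.eventually hqs.hasFPowerSeriesAt.eventually_hasSum]
    with Y h1 h2
  have h3 := hasSum_axial h1
  simp only [zero_add] at h2
  simp_rw [hq, FormalMultilinearSeries.ofScalars_apply_eq] at h2
  have h4 : ((X 0 : ℝ) : ℂ) + ⟨Y 0 - X 0, ‖vpart Y‖⟩ = ⟨Y 0, ‖vpart Y‖⟩ := by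
    apply Complex.ext <;> simp
  rw [h4] at h3
  rw [axial, h2.unique h3]

theorem contDiffAt_axial_of_vpart_ne_zero {h : ℂ → ℂ} {P : E m → Cl m} {X : E (m + 1)}
    (hX : vpart X ≠ 0) (hh : AnalyticAt ℂ h ⟨X 0, ‖vpart X‖⟩)
    (hP : ContDiffAt ℝ ω P (vpart X)) : ContDiffAt ℝ ω (axial h P) X := by
  have hn : ContDiffAt ℝ ω (fun Y : E (m + 1) => ‖vpart Y‖) X :=
    (contDiffAt_norm ℝ hX).comp X (vpartL m).contDiff.contDiffAt
  have hz : ContDiffAt ℝ ω (fun Y : E (m + 1) => (⟨Y 0, ‖vpart Y‖⟩ : ℂ)) X := by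
    have : (fun Y : E (m + 1) => (⟨Y 0, ‖vpart Y‖⟩ : ℂ)) =
        fun Y => Complex.equivRealProdCLM.symm (Y 0, ‖vpart Y‖) := by
      funext Y; apply Complex.ext <;> simp
    rw [this]
    exact Complex.equivRealProdCLM.symm.contDiff.contDiffAt.comp X
      ((spartL m).contDiff.contDiffAt.prodMk hn)
  have hh' : ContDiffAt ℝ ω (fun Y : E (m + 1) => h ⟨Y 0, ‖vpart Y‖⟩) X :=
    ContDiffAt.comp (g := h) X (hh.contDiffAt.restrict_scalars ℝ) hz
  have hre : ContDiffAt ℝ ω (fun Y : E (m + 1) => (h ⟨Y 0, ‖vpart Y‖⟩).re) X :=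
    Complex.reCLM.contDiff.contDiffAt.comp X hh'
  have him : ContDiffAt ℝ ω (fun Y : E (m + 1) => (h ⟨Y 0, ‖vpart Y‖⟩).im) X :=
    Complex.imCLM.contDiff.contDiffAt.comp X hh'
  have hv : ContDiffAt ℝ ω (fun Y : E (m + 1) => vec (vpart Y)) X :=
    ((vecL m).contDiff.comp (vpartL m).contDiff).contDiffAt
  have hre' : ContDiffAt ℝ ω (fun Y : E (m + 1) => algebraMap ℝ (Cl m) (h ⟨Y 0, ‖vpart Y‖⟩).re) X :=
    (Algebra.linearMap ℝ (Cl m)).toContinuousLinearMap.contDiff.contDiffAt.comp X hre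
  exact (hre'.add (him.smul ((hn.inv (norm_ne_zero_iff.2 hX)).smul hv))).mul
    (hP.comp X (vpartL m).contDiff.contDiffAt)

/-! ### The function `(1 + z²)^β` -/

/-- The real part 1 + t² - r² is positive for |r| < 1 and every t. This is why the whole cylinder is
reached. -/
theorem one_add_sq_mem_slitPlane {t r : ℝ} (hr : |r| < 1) :
    1 + (⟨t, r⟩ : ℂ) ^ 2 ∈ Complex.slitPlane := by
  rw [Complex.mem_slitPlane_iff]
  have hr2 : r ^ 2 < 1 := (sq_lt_one_iff_abs_lt_one r).2 hr
  by_cases h : t * r = 0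
  · left
    simp only [Complex.add_re, Complex.one_re, pow_two, Complex.mul_re]
    nlinarith [sq_nonneg t]
  · right
    simp only [Complex.add_im, Complex.one_im, pow_two, Complex.mul_im]
    intro h'
    exact h (by linarith)

theorem analyticAt_onePlusSqPow (β : ℝ) {z : ℂ} (hz : |z.im| < 1) :
    AnalyticAt ℂ (onePlusSqPow β) z := by
  have h1 : AnalyticAt ℂ (fun z : ℂ => 1 + z ^ 2) z := by fun_prop
  exact h1.cpow analyticAt_const (one_add_sq_mem_slitPlane (t := z.re) hz)

theorem onePlusSqPow_ofReal (β x : ℝ) : (onePlusSqPow β x).im = 0 := by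
  rw [onePlusSqPow]
  have : (1 + (x : ℂ) ^ 2) = ((1 + x ^ 2 : ℝ) : ℂ) := by push_cast; rfl
  rw [this, ← Complex.ofReal_cpow (by positivity)]
  exact Complex.ofReal_im _

theorem onePlusSqPow_imag (β : ℝ) {r : ℝ} (hr : |r| < 1) :
    onePlusSqPow β ⟨0, r⟩ = ((1 - r ^ 2) ^ β : ℝ) := by
  have hr2 : r ^ 2 < 1 := (sq_lt_one_iff_abs_lt_one r).2 hr
  have : (1 + (⟨0, r⟩ : ℂ) ^ 2) = ((1 - r ^ 2 : ℝ) : ℂ) := by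
    apply Complex.ext <;> simp [pow_two]; ring
  rw [onePlusSqPow, this, ← Complex.ofReal_cpow (by linarith)]

/-- The open cylinder `|x| < 1` in `ℝ^{m+1}`. -/
def cylinder (m : ℕ) : Set (E (m + 1)) := {X | ‖vpart X‖ < 1}

theorem isOpen_cylinder : IsOpen (cylinder m) :=
  isOpen_lt (vpartL m).continuous.norm continuous_const

theorem contDiffAt_axial_onePlusSqPow (β : ℝ) {P : E m → Cl m} (hP : ContDiff ℝ ω P)
    {X : E (m + 1)} (hX : X ∈ cylinder m) : ContDiffAt ℝ ω (axial (onePlusSqPow β) P) X := by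
  have hX' : |‖vpart X‖| < 1 := by rwa [abs_norm]
  by_cases h : vpart X = 0
  · exact contDiffAt_axial_of_vpart_eq_zero h (analyticAt_onePlusSqPow β (by simp))
      (Eventually.of_forall (onePlusSqPow_ofReal β)) hP.contDiffAt
  · exact contDiffAt_axial_of_vpart_ne_zero h (analyticAt_onePlusSqPow β hX') hP.contDiffAt

/-! ### Axial functions in the coordinates `(t, s) = (x_0, |x|²)` -/

/-- The strip `0 < s < 1`. -/
def strip : Set (ℝ × ℝ) := {q | 0 < q.2 ∧ q.2 < 1}

theorem isOpen_strip : IsOpen strip :=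
  (isOpen_lt continuous_const continuous_snd).inter (isOpen_lt continuous_snd continuous_const)

/-- The partial derivative in the second variable. -/
def dsnd (f : ℝ × ℝ → ℝ) (q : ℝ × ℝ) : ℝ := fderiv ℝ f q (0, 1)

/-- Real analyticity on the strip. -/
def StripAnalytic (f : ℝ × ℝ → ℝ) : Prop := ∀ q ∈ strip, ContDiffAt ℝ ω f q

theorem StripAnalytic.dsnd {f : ℝ × ℝ → ℝ} (hf : StripAnalytic f) : StripAnalytic (dsnd f) :=
  fun q hq => ((hf q hq).fderiv_right (m := ω) le_rfl).clm_apply contDiffAt_const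

theorem StripAnalytic.iterate_dsnd {f : ℝ × ℝ → ℝ} (hf : StripAnalytic f) (n : ℕ) :
    StripAnalytic (CliffordFueter.dsnd^[n] f) := by
  induction n with
  | zero => exact hf
  | succ n ih => rw [Function.iterate_succ_apply']; exact ih.dsnd

theorem StripAnalytic.hasFDerivAt {f : ℝ × ℝ → ℝ} (hf : StripAnalytic f) {q : ℝ × ℝ}
    (hq : q ∈ strip) : HasFDerivAt f (fderiv ℝ f q) q :=
  ((hf q hq).differentiableAt (by simp)).hasFDerivAt

theorem StripAnalytic.fderiv_dsnd {f : ℝ × ℝ → ℝ} (hf : StripAnalytic f) {q : ℝ × ℝ}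
    (hq : q ∈ strip) :
    fderiv ℝ (CliffordFueter.dsnd f) q (1, 0) =
      CliffordFueter.dsnd (fun p => fderiv ℝ f p (1, 0)) q := by
  have h : DifferentiableAt ℝ (fderiv ℝ f) q :=
    ((hf q hq).fderiv_right (m := ω) le_rfl).differentiableAt (by simp)
  have h1 (w : ℝ × ℝ) := (h.hasFDerivAt.clm_apply (hasFDerivAt_const w q)).fderiv
  have h2 : fderiv ℝ (CliffordFueter.dsnd f) q = _ := h1 (0, 1)
  rw [CliffordFueter.dsnd, h1, h2]
  have hs : IsSymmSndFDerivAt ℝ f q := (hf q hq).isSymmSndFDerivAt_of_omega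
  simpa using hs (1, 0) (0, 1)

/-- The system satisfied by the pair `(u, v / r)` for holomorphic `u + iv`, in the coordinates
`(t, s) = (x_0, r²)`. -/
structure VekuaPair (U W : ℝ × ℝ → ℝ) : Prop where
  analytic_left : StripAnalytic U
  analytic_right : StripAnalytic W
  left : ∀ q ∈ strip, fderiv ℝ U q (1, 0) = W q + 2 * q.2 * dsnd W q
  right : ∀ q ∈ strip, fderiv ℝ W q (1, 0) = -2 * dsnd U q

theorem dsnd_congr {f g : ℝ × ℝ → ℝ} {q : ℝ × ℝ} (h : f =ᶠ[𝓝 q] g) : dsnd f q = dsnd g q := by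
  rw [dsnd, h.fderiv_eq, dsnd]

/-- Each ∂_s commutes with ∂_t, and when it hits the coefficient 2s it adds two more copies of the
current derivative of W: 2n + 1 becomes 2n + 3. -/
theorem VekuaPair.iterate {U W : ℝ × ℝ → ℝ} (h : VekuaPair U W) (n : ℕ) :
    (∀ q ∈ strip, fderiv ℝ (dsnd^[n] U) q (1, 0) =
      (2 * n + 1) * dsnd^[n] W q + 2 * q.2 * dsnd^[n + 1] W q) ∧
    ∀ q ∈ strip, fderiv ℝ (dsnd^[n] W) q (1, 0) = -2 * dsnd^[n + 1] U q := by
  induction n with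
  | zero => exact ⟨fun q hq => by simpa using h.left q hq, fun q hq => by simpa using h.right q hq⟩
  | succ n ih =>
    have hev (q : ℝ × ℝ) (hq : q ∈ strip) : ∀ᶠ p in 𝓝 q, p ∈ strip := isOpen_strip.mem_nhds hq
    constructor
    · intro q hq
      rw [Function.iterate_succ_apply', (h.analytic_left.iterate_dsnd n).fderiv_dsnd hq,
        dsnd_congr (g := fun p => (2 * n + 1) * dsnd^[n] W p + 2 * p.2 * dsnd^[n + 1] W p)
        ((hev q hq).mono fun p hp => ih.1 p hp)]
      have h1 := (((h.analytic_right.iterate_dsnd n).hasFDerivAt hq).const_mul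
        ((2 * n + 1 : ℝ))).add ((((hasFDerivAt_snd (𝕜 := ℝ) (p := q)).const_mul (2 : ℝ))).mul
        ((h.analytic_right.iterate_dsnd (n + 1)).hasFDerivAt hq))
      have h2 : fderiv ℝ (fun p : ℝ × ℝ => (2 * n + 1) * dsnd^[n] W p
        + 2 * p.2 * dsnd^[n + 1] W p) q = _ := h1.fderiv
      rw [dsnd, h2]
      have e1 : fderiv ℝ (dsnd^[n] W) q (0, 1) = dsnd^[n + 1] W q := by
        rw [Function.iterate_succ_apply']; rfl
      have e2 : fderiv ℝ (dsnd^[n + 1] W) q (0, 1) = dsnd^[n + 1 + 1] W q := by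
        rw [Function.iterate_succ_apply' _ (n + 1)]; rfl
      simp only [add_apply, smul_apply, smul_eq_mul, e1, e2, ContinuousLinearMap.coe_snd']
      push_cast
      ring
    · intro q hq
      rw [Function.iterate_succ_apply', (h.analytic_right.iterate_dsnd n).fderiv_dsnd hq,
        dsnd_congr (g := fun p => -2 * dsnd^[n + 1] U p)
        ((hev q hq).mono fun p hp => ih.2 p hp)]
      have h1 := ((h.analytic_left.iterate_dsnd (n + 1)).hasFDerivAt hq).const_mul (-2 : ℝ)
      rw [dsnd, h1.fderiv, Function.iterate_succ_apply' _ (n + 1)]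
      rfl

/-- The function `u` in the coordinates `(t, s) = (x_0, r²)`. -/
def rePart (h : ℂ → ℂ) (q : ℝ × ℝ) : ℝ := (h ⟨q.1, √q.2⟩).re

/-- The function `v / r` in the coordinates `(t, s) = (x_0, r²)`. -/
def imPart (h : ℂ → ℂ) (q : ℝ × ℝ) : ℝ := (h ⟨q.1, √q.2⟩).im * (√q.2)⁻¹

theorem vekuaPair_of_analytic {h : ℂ → ℂ}
    (hh : ∀ z : ℂ, 0 < z.im → z.im < 1 → AnalyticAt ℂ h z) : VekuaPair (rePart h) (imPart h) := by
  have hsq (q : ℝ × ℝ) (hq : q ∈ strip) : 0 < √q.2 := Real.sqrt_pos.2 hq.1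
  have hlt (q : ℝ × ℝ) (hq : q ∈ strip) : √q.2 < 1 := by
    rw [Real.sqrt_lt' one_pos]; simpa using hq.2
  have hsm (q : ℝ × ℝ) (hq : q ∈ strip) : ContDiffAt ℝ ω (fun q : ℝ × ℝ => √q.2) q :=
    contDiffAt_snd.sqrt hq.1.ne'
  have hsm2 (q : ℝ × ℝ) (hq : q ∈ strip) :
      ContDiffAt ℝ ω (fun q : ℝ × ℝ => h ⟨q.1, √q.2⟩) q := by
    have hz : ContDiffAt ℝ ω (fun q : ℝ × ℝ => (⟨q.1, √q.2⟩ : ℂ)) q := by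
      have : (fun q : ℝ × ℝ => (⟨q.1, √q.2⟩ : ℂ)) =
          fun q => Complex.equivRealProdCLM.symm (q.1, √q.2) := by
        funext Y; apply Complex.ext <;> simp
      rw [this]
      exact Complex.equivRealProdCLM.symm.contDiff.contDiffAt.comp q
        (contDiffAt_fst.prodMk (hsm q hq))
    exact ContDiffAt.comp (g := h) q
      (((hh ⟨q.1, √q.2⟩ (hsq q hq) (hlt q hq)).contDiffAt).restrict_scalars ℝ) hz
  -- With r = √s one has L(1,0) = h'(z) and L(0,1) = i h'(z) / (2r); the two identities are the
  -- Cauchy-Riemann equations.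
  have hmain (q : ℝ × ℝ) (hq : q ∈ strip) : ∃ L : ℝ × ℝ →L[ℝ] ℂ,
      HasFDerivAt (fun q : ℝ × ℝ => h ⟨q.1, √q.2⟩) L q ∧
      (L (0, 1)).re = -((2 * √q.2)⁻¹ * (L (1, 0)).im) ∧
      (L (0, 1)).im = (2 * √q.2)⁻¹ * (L (1, 0)).re := by
    have h1 : HasFDerivAt (fun q : ℝ × ℝ => √q.2)
        ((1 / (2 * √q.2)) • ContinuousLinearMap.snd ℝ ℝ ℝ) q :=
      (Real.hasDerivAt_sqrt hq.1.ne').comp_hasFDerivAt q hasFDerivAt_snd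
    have h2 : HasFDerivAt (fun q : ℝ × ℝ => (⟨q.1, √q.2⟩ : ℂ)) _ q :=
      (Complex.equivRealProdCLM.symm.hasFDerivAt (x := (q.1, √q.2))).comp q
        (hasFDerivAt_fst.prodMk h1)
    have h3 : HasDerivAt h (deriv h ⟨q.1, √q.2⟩) ⟨q.1, √q.2⟩ :=
      (hh ⟨q.1, √q.2⟩ (hsq q hq) (hlt q hq)).differentiableAt.hasDerivAt
    have h4 : HasFDerivAt (fun q : ℝ × ℝ => h ⟨q.1, √q.2⟩) _ q :=
      HasFDerivAt.comp (g := h) q (h3.hasFDerivAt.restrictScalars ℝ) h2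
    refine ⟨_, h4, ?_, ?_⟩
    · simp [Complex.equivRealProdCLM_symm_apply]
    · simp [Complex.equivRealProdCLM_symm_apply]
  have hU (q : ℝ × ℝ) (hq : q ∈ strip) : ContDiffAt ℝ ω (rePart h) q :=
    Complex.reCLM.contDiff.contDiffAt.comp q (hsm2 q hq)
  have hW (q : ℝ × ℝ) (hq : q ∈ strip) : ContDiffAt ℝ ω (imPart h) q :=
    (Complex.imCLM.contDiff.contDiffAt.comp q (hsm2 q hq)).mul ((hsm q hq).inv (hsq q hq).ne')
  have hd (q : ℝ × ℝ) (hq : q ∈ strip) : ∃ a b : ℝ,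
      fderiv ℝ (rePart h) q (1, 0) = a ∧ dsnd (rePart h) q = -((2 * √q.2)⁻¹ * b) ∧
      fderiv ℝ (imPart h) q (1, 0) = b * (√q.2)⁻¹ ∧
      dsnd (imPart h) q = (2 * √q.2)⁻¹ * a * (√q.2)⁻¹
        - (h ⟨q.1, √q.2⟩).im * (2 * q.2 * √q.2)⁻¹ := by
    obtain ⟨L, hL, hL1, hL2⟩ := hmain q hq
    have h1 : HasFDerivAt (rePart h) (Complex.reCLM.comp L) q :=
      Complex.reCLM.hasFDerivAt.comp q hL
    have h2 : HasFDerivAt (fun q : ℝ × ℝ => (h ⟨q.1, √q.2⟩).im) (Complex.imCLM.comp L) q :=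
      Complex.imCLM.hasFDerivAt.comp q hL
    have h3 : HasFDerivAt (fun q : ℝ × ℝ => (√q.2)⁻¹)
        ((-(1 / (2 * √q.2)) / (√q.2) ^ 2) • ContinuousLinearMap.snd ℝ ℝ ℝ) q :=
      ((Real.hasDerivAt_sqrt hq.1.ne').inv (hsq q hq).ne').comp_hasFDerivAt q hasFDerivAt_snd
    have h4 : HasFDerivAt (imPart h) _ q := h2.mul h3
    refine ⟨(L (1, 0)).re, (L (1, 0)).im, ?_, ?_, ?_, ?_⟩
    · rw [h1.fderiv]; rfl
    · rw [dsnd, h1.fderiv, ← hL1]; rfl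
    · rw [h4.fderiv]; simp [mul_comm]
    · rw [dsnd, h4.fderiv]
      have := hsq q hq
      have hq1 := hq.1
      simp [hL2, Real.sq_sqrt hq1.le]
      field_simp
      ring
  refine ⟨hU, hW, fun q hq => ?_, fun q hq => ?_⟩
  · obtain ⟨a, b, h1, h2, h3, h4⟩ := hd q hq
    rw [h1, h4, imPart]
    have := hsq q hq
    have hq1 := hq.1
    have hq2 : √q.2 ^ 2 = q.2 := Real.sq_sqrt hq1.le
    field_simp
    rw [hq2]
    ring
  · obtain ⟨a, b, h1, h2, h3, h4⟩ := hd q hq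
    rw [h3, h2]
    have := hsq q hq
    field_simp

/-! ### The Laplacian on radial pairs away from the axis. -/

/-- The cylinder without its axis. -/
def puncturedCylinder (m : ℕ) : Set (E (m + 1)) := {X | vpart X ≠ 0 ∧ ‖vpart X‖ < 1}

theorem isOpen_puncturedCylinder : IsOpen (puncturedCylinder m) :=
  (isOpen_ne.preimage (vpartL m).continuous).inter isOpen_cylinder

theorem mem_strip {X : E (m + 1)} (hX : X ∈ puncturedCylinder m) :
    (X 0, ‖vpart X‖ ^ 2) ∈ strip := by
  have h := norm_pos_iff.2 hX.1
  exact ⟨by positivity, (sq_lt_one_iff₀ h.le).2 hX.2⟩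

/-- The function `(U(x_0, |x|²) + x W(x_0, |x|²)) P(x)`. -/
def radialPair (U W : ℝ × ℝ → ℝ) (P : E m → Cl m) (X : E (m + 1)) : Cl m :=
  U (X 0, ‖vpart X‖ ^ 2) • P (vpart X) + W (X 0, ‖vpart X‖ ^ 2) • (vec (vpart X) * P (vpart X))

theorem axial_eq_radialPair (h : ℂ → ℂ) (P : E m → Cl m) (X : E (m + 1)) :
    axial h P X = radialPair (rePart h) (imPart h) P X := by
  simp only [axial, radialPair, rePart, imPart, Real.sqrt_sq (norm_nonneg _)]
  rw [add_mul, ← Algebra.smul_def, smul_smul, smul_mul_assoc]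

theorem contDiffAt_radial {A : ℝ × ℝ → ℝ} (hA : StripAnalytic A) {Q : E m → Cl m}
    (hQ : ContDiff ℝ ω Q) {X : E (m + 1)} (hX : X ∈ puncturedCylinder m) :
    ContDiffAt ℝ ω (fun Y : E (m + 1) => A (Y 0, ‖vpart Y‖ ^ 2) • Q (vpart Y)) X := by
  have h1 : ContDiff ℝ ω fun Y : E (m + 1) => (Y 0, ‖vpart Y‖ ^ 2) :=
    (spartL m).contDiff.prodMk ((vpartL m).contDiff.norm_sq ℝ)
  exact ContDiffAt.smul (ContDiffAt.comp (g := A) X (hA _ (mem_strip hX)) h1.contDiffAt)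
    (hQ.comp (vpartL m).contDiff).contDiffAt

theorem contDiff_vec_mul {P : E m → Cl m} (hP : ContDiff ℝ ω P) :
    ContDiff ℝ ω fun x => vec x * P x :=
  (vecL m).contDiff.mul hP

theorem contDiffAt_radialPair {U W : ℝ × ℝ → ℝ} (h : VekuaPair U W) {P : E m → Cl m}
    (hP : ContDiff ℝ ω P) (n : ℕ) {X : E (m + 1)} (hX : X ∈ puncturedCylinder m) :
    ContDiffAt ℝ ω (radialPair (dsnd^[n] U) (dsnd^[n] W) P) X :=
  (contDiffAt_radial (h.analytic_left.iterate_dsnd n) hP hX).add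
    (contDiffAt_radial (h.analytic_right.iterate_dsnd n) (contDiff_vec_mul hP) hX)

section

variable {U W : ℝ × ℝ → ℝ} {k N : ℕ} {P : E m → Cl m}

/-- The x P terms cancel by W_t = -2 U_s. In the P terms x² = -s removes 2s W_s, and the coefficient
of W that survives is (2n + 1) - (2k + m) = 2(n - N). -/
theorem cauchyRiemann_radialPair (h : VekuaPair U W) (hP : IsHomogeneousMonogenic k P)
    (hN : 2 * k + m = 2 * N + 1) (n : ℕ) {X : E (m + 1)} (hX : X ∈ puncturedCylinder m) :
    cauchyRiemann (radialPair (dsnd^[n] U) (dsnd^[n] W) P) X =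
      (2 * ((n : ℝ) - N) * dsnd^[n] W (X 0, ‖vpart X‖ ^ 2)) • P (vpart X) := by
  have hs := mem_strip hX
  have hPs := hP.1.contDiff
  have hU := h.analytic_left.iterate_dsnd n
  have hW := h.analytic_right.iterate_dsnd n
  have hPd : DifferentiableAt ℝ P (vpart X) := hPs.differentiable (by simp) _
  have hvd : DifferentiableAt ℝ (fun x => vec x * P x) (vpart X) :=
    (contDiff_vec_mul hPs).differentiable (by simp) _
  have h1 := cauchyRiemann_radial_smul (hU.hasFDerivAt hs) hPd
  have h2 := cauchyRiemann_radial_smul (hW.hasFDerivAt hs) hvd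
  have h3 := cauchyRiemann_add ((contDiffAt_radial hU hPs hX).differentiableAt (by simp))
    ((contDiffAt_radial hW (contDiff_vec_mul hPs) hX).differentiableAt (by simp))
  have e1 : fderiv ℝ (dsnd^[n] U) (X 0, ‖vpart X‖ ^ 2) (0, 1) =
      dsnd^[n + 1] U (X 0, ‖vpart X‖ ^ 2) := by
    rw [Function.iterate_succ_apply']; rfl
  have e2 : fderiv ℝ (dsnd^[n] W) (X 0, ‖vpart X‖ ^ 2) (0, 1) =
      dsnd^[n + 1] W (X 0, ‖vpart X‖ ^ 2) := by
    rw [Function.iterate_succ_apply']; rfl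
  refine h3.trans ?_
  rw [h1, h2, e1, e2, (h.iterate n).1 _ hs, (h.iterate n).2 _ hs, hP.2, hP.dirac_vec_mul,
    vec_mul_vec_mul]
  have hN' : (2 * k + m : ℝ) = 2 * N + 1 := by exact_mod_cast hN
  rw [hN']
  module

/-- The x_0-derivative of W supplies -2 U_s, and the conjugate sign supplies -2 W_s x: together, -2
times the next pair. -/
theorem conjCauchyRiemann_radial (h : VekuaPair U W) (hP : IsHomogeneousMonogenic k P)
    (c : ℝ) (n : ℕ) {X : E (m + 1)} (hX : X ∈ puncturedCylinder m) :
    conjCauchyRiemann (fun Y : E (m + 1) => (c * dsnd^[n] W (Y 0, ‖vpart Y‖ ^ 2)) • P (vpart Y)) X =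
      (-2 * c) • radialPair (dsnd^[n + 1] U) (dsnd^[n + 1] W) P X := by
  have hs := mem_strip hX
  have hW := h.analytic_right.iterate_dsnd n
  have hPd : DifferentiableAt ℝ P (vpart X) := hP.1.contDiff.differentiable (by simp) _
  have h1 := conjCauchyRiemann_radial_smul ((hW.hasFDerivAt hs).const_mul c) hPd
  have e2 : fderiv ℝ (dsnd^[n] W) (X 0, ‖vpart X‖ ^ 2) (0, 1) =
      dsnd^[n + 1] W (X 0, ‖vpart X‖ ^ 2) := by
    rw [Function.iterate_succ_apply']; rfl
  rw [h1, smul_apply, smul_apply, e2, (h.iterate n).2 _ hs, hP.2, radialPair]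
  simp only [smul_eq_mul]
  module

theorem laplacian_radialPair (h : VekuaPair U W) (hP : IsHomogeneousMonogenic k P)
    (hN : 2 * k + m = 2 * N + 1) (n : ℕ) {X : E (m + 1)} (hX : X ∈ puncturedCylinder m) :
    Laplacian.laplacian (radialPair (dsnd^[n] U) (dsnd^[n] W) P) X =
      (4 * ((N : ℝ) - n)) • radialPair (dsnd^[n + 1] U) (dsnd^[n + 1] W) P X := by
  rw [laplacian_eq_conjCauchyRiemann (contDiffAt_radialPair h hP.1.contDiff n hX),
    conjCauchyRiemann_congr ((isOpen_puncturedCylinder.eventually_mem hX).mono fun Y hY =>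
      cauchyRiemann_radialPair h hP hN n hY), conjCauchyRiemann_radial h hP _ n hX]
  congr 1
  ring

theorem iterate_laplacian_radialPair (h : VekuaPair U W) (hP : IsHomogeneousMonogenic k P)
    (hN : 2 * k + m = 2 * N + 1) (n : ℕ) {X : E (m + 1)} (hX : X ∈ puncturedCylinder m) :
    (fun f : E (m + 1) → Cl m => Laplacian.laplacian f)^[n] (radialPair U W P) X =
      (∏ i ∈ Finset.range n, (4 * ((N : ℝ) - i))) •
        radialPair (dsnd^[n] U) (dsnd^[n] W) P X := by
  induction n generalizing X with
  | zero => simp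
  | succ n ih =>
    rw [Function.iterate_succ_apply', (InnerProductSpace.laplacian_congr_nhds (f₂ :=
      (∏ i ∈ Finset.range n, (4 * ((N : ℝ) - i))) • radialPair (dsnd^[n] U) (dsnd^[n] W) P)
      ((isOpen_puncturedCylinder.eventually_mem hX).mono fun Y hY => ih hY)).eq_of_nhds,
      InnerProductSpace.laplacian_smul _
      ((contDiffAt_radialPair h hP.1.contDiff n hX).of_le le_top),
      laplacian_radialPair h hP hN n hX, smul_smul, Finset.prod_range_succ]

end

/-! ### Regularity of the Fueter transform -/

theorem ContDiffAt.cauchyRiemann {f : E (m + 1) → Cl m} {X : E (m + 1)}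
    (hf : ContDiffAt ℝ ω f X) : ContDiffAt ℝ ω (CliffordFueter.cauchyRiemann f) X := by
  have h := hf.fderiv_right (m := ω) le_rfl
  exact (h.clm_apply contDiffAt_const).add (ContDiffAt.sum fun j _ =>
    contDiffAt_const.mul (h.clm_apply contDiffAt_const))

theorem ContDiffAt.conjCauchyRiemann {f : E (m + 1) → Cl m} {X : E (m + 1)}
    (hf : ContDiffAt ℝ ω f X) : ContDiffAt ℝ ω (CliffordFueter.conjCauchyRiemann f) X := by
  have h := hf.fderiv_right (m := ω) le_rfl
  exact (h.clm_apply contDiffAt_const).sub (ContDiffAt.sum fun j _ =>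
    contDiffAt_const.mul (h.clm_apply contDiffAt_const))

theorem ContDiffAt.iterate_laplacian {f : E (m + 1) → Cl m} {X : E (m + 1)}
    (hf : ContDiffAt ℝ ω f X) (n : ℕ) :
    ContDiffAt ℝ ω ((fun f : E (m + 1) → Cl m => Laplacian.laplacian f)^[n] f) X := by
  induction n with
  | zero => exact hf
  | succ n ih =>
    rw [Function.iterate_succ_apply']
    exact (ContDiffAt.conjCauchyRiemann (ContDiffAt.cauchyRiemann ih)).congr_of_eventuallyEq
      ((ih.eventually (by simp)).mono fun Y hY => laplacian_eq_conjCauchyRiemann hY)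

/-! ### Values on the hyperplane `x_0 = 0` -/

theorem dsnd_eq_deriv {f : ℝ × ℝ → ℝ} (hf : StripAnalytic f) {q : ℝ × ℝ} (hq : q ∈ strip) :
    HasDerivAt (fun s => f (q.1, s)) (dsnd f q) q.2 :=
  (hf.hasFDerivAt hq).comp_hasDerivAt q.2 ((hasDerivAt_const q.2 q.1).prodMk (hasDerivAt_id q.2))

theorem iterate_dsnd_eq_zero {W : ℝ × ℝ → ℝ} (hW : StripAnalytic W)
    (h0 : ∀ s, (0, s) ∈ strip → W (0, s) = 0) (n : ℕ) :
    ∀ s, (0, s) ∈ strip → dsnd^[n] W (0, s) = 0 := by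
  induction n with
  | zero => exact h0
  | succ n ih =>
    intro s hs
    have h1 := dsnd_eq_deriv (hW.iterate_dsnd n) hs
    have hev : ∀ᶠ σ in 𝓝 s, ((0 : ℝ), σ) ∈ strip :=
      (Continuous.prodMk_right (0 : ℝ)).continuousAt.eventually (isOpen_strip.mem_nhds hs)
    have h2 : HasDerivAt (fun σ => dsnd^[n] W (0, σ)) 0 s :=
      (hasDerivAt_const s 0).congr_of_eventuallyEq (hev.mono fun σ hσ => ih σ hσ)
    rw [Function.iterate_succ_apply']
    exact h1.unique h2

theorem iterate_dsnd_one_sub_rpow {U : ℝ × ℝ → ℝ} (hU : StripAnalytic U) (β : ℝ)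
    (h0 : ∀ s, (0, s) ∈ strip → U (0, s) = (1 - s) ^ β) (n : ℕ) :
    ∀ s, (0, s) ∈ strip → dsnd^[n] U (0, s) =
      ((-1) ^ n * ∏ i ∈ Finset.range n, (β - i)) * (1 - s) ^ (β - n) := by
  induction n with
  | zero => simpa using h0
  | succ n ih =>
    intro s hs
    have h1 := dsnd_eq_deriv (hU.iterate_dsnd n) hs
    have hev : ∀ᶠ σ in 𝓝 s, ((0 : ℝ), σ) ∈ strip :=
      (Continuous.prodMk_right (0 : ℝ)).continuousAt.eventually (isOpen_strip.mem_nhds hs)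
    have hpos : 0 < 1 - s := by have := hs.2; simp only at this; linarith
    have h2 : HasDerivAt (fun σ => dsnd^[n] U (0, σ)) _ s :=
      ((((hasDerivAt_id s).const_sub 1).rpow_const (p := β - n) (Or.inl hpos.ne')).const_mul
        ((-1) ^ n * ∏ i ∈ Finset.range n, (β - i))).congr_of_eventuallyEq
        (hev.mono fun σ hσ => ih σ hσ)
    rw [Function.iterate_succ_apply']
    refine (h1.unique h2).trans ?_
    rw [Finset.prod_range_succ, Nat.cast_succ, ← sub_sub]
    simp only [id]
    ring

theorem prod_range_sub_eq_prod_Icc (α : ℝ) (N : ℕ) :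
    ∏ i ∈ Finset.range N, (α + N - i) = ∏ j ∈ Finset.Icc 1 N, (α + (j : ℝ)) := by
  induction N generalizing α with
  | zero => simp
  | succ N ih =>
    rw [Finset.prod_range_succ', Finset.prod_Icc_succ_top (by omega), ← ih]
    push_cast
    congr 1
    · exact Finset.prod_congr rfl fun i _ => by ring
    · ring

theorem prod_range_four_mul (N : ℕ) :
    ∏ i ∈ Finset.range N, (4 * ((N : ℝ) - i)) = 2 ^ N * ((2 * N).doubleFactorial : ℝ) := by
  rw [Nat.doubleFactorial_two_mul]
  have h := prod_range_sub_eq_prod_Icc 0 N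
  simp only [zero_add] at h
  have hf : ∏ j ∈ Finset.Icc 1 N, (j : ℝ) = (N.factorial : ℝ) := by
    clear h
    induction N with
    | zero => simp
    | succ N ih =>
      rw [Finset.prod_Icc_succ_top (by omega), ih, Nat.factorial_succ, Nat.cast_mul, mul_comm]
  rw [Finset.prod_mul_distrib, h, hf]
  simp only [Finset.prod_const, Finset.card_range]
  push_cast
  rw [← mul_assoc, ← mul_pow]
  norm_num

/-! ### Density of the complement of the axis -/

/-- A point of the axis can be moved off it along e_1, which exists because m ≥ 1. -/
theorem frequently_puncturedCylinder [NeZero m] {X : E (m + 1)} (hX : X ∈ cylinder m) :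
    ∃ᶠ Y in 𝓝 X, Y ∈ puncturedCylinder m := by
  by_cases h : vpart X = 0
  · set v : E (m + 1) := EuclideanSpace.single (Fin.succ 0) 1 with hv
    have ht : Tendsto (fun t : ℝ => X + t • v) (𝓝[≠] 0) (𝓝 X) := by
      have : Continuous fun t : ℝ => X + t • v := by fun_prop
      have h2 := this.tendsto 0
      simp only [zero_smul, add_zero] at h2
      exact h2.mono_left nhdsWithin_le_nhds
    refine ht.frequently (Eventually.frequently ?_)
    filter_upwards [ht.eventually (isOpen_cylinder.mem_nhds hX), self_mem_nhdsWithin] with t h1 h2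
    refine ⟨?_, h1⟩
    rw [← vpartL_apply, map_add, map_smul, vpartL_apply, vpartL_apply, h, zero_add, hv,
      vpart_single_succ]
    exact smul_ne_zero h2 (by simp)
  · exact (isOpen_puncturedCylinder.eventually_mem ⟨h, hX⟩).frequently

/-! ### The Fueter transform of (1 + z²)^β: monogenicity and boundary values. -/

section

variable {k p : ℕ} {P : E m → Cl m}

theorem contDiffAt_Ft (β : ℝ) (hP : IsHomogeneousMonogenic k P) {X : E (m + 1)}
    (hX : X ∈ cylinder m) : ContDiffAt ℝ ω (Ft k (onePlusSqPow β) P) X :=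
  ContDiffAt.iterate_laplacian (contDiffAt_axial_onePlusSqPow β hP.1.contDiff hX) _

theorem vekuaPair_onePlusSqPow (β : ℝ) :
    VekuaPair (rePart (onePlusSqPow β)) (imPart (onePlusSqPow β)) :=
  vekuaPair_of_analytic fun z h0 h1 => analyticAt_onePlusSqPow β (by rwa [abs_of_pos h0])

theorem Ft_eq_radialPair (β : ℝ) (hP : IsHomogeneousMonogenic k P) (hm : m = 2 * p + 1)
    {X : E (m + 1)} (hX : X ∈ puncturedCylinder m) :
    Ft k (onePlusSqPow β) P X = (2 ^ (k + p) * ((2 * (k + p)).doubleFactorial : ℝ)) •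
      radialPair (dsnd^[k + p] (rePart (onePlusSqPow β))) (dsnd^[k + p] (imPart (onePlusSqPow β)))
        P X := by
  have hN : k + (m - 1) / 2 = k + p := by omega
  rw [Ft, hN, funext (axial_eq_radialPair (onePlusSqPow β) P),
    iterate_laplacian_radialPair (N := k + p) (vekuaPair_onePlusSqPow β) hP (by omega) _ hX,
    prod_range_four_mul]

theorem cauchyRiemann_Ft (β : ℝ) (hP : IsHomogeneousMonogenic k P) (hm : m = 2 * p + 1)
    {X : E (m + 1)} (hX : X ∈ cylinder m) : cauchyRiemann (Ft k (onePlusSqPow β) P) X = 0 := by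
  have : NeZero m := ⟨by omega⟩
  -- The left side is continuous on the cylinder, so vanishing off the axis suffices.
  refine tendsto_nhds_unique_of_frequently_eq (l := 𝓝 X)
    (ContDiffAt.cauchyRiemann (contDiffAt_Ft β hP hX)).continuousAt tendsto_const_nhds
    ((frequently_puncturedCylinder hX).mono fun Y hY => ?_)
  rw [cauchyRiemann_congr ((isOpen_puncturedCylinder.eventually_mem hY).mono fun Z hZ =>
    Ft_eq_radialPair β hP hm hZ)]
  set c : ℝ := 2 ^ (k + p) * ((2 * (k + p)).doubleFactorial : ℝ)
  have h1 := cauchyRiemann_radialPair (N := k + p) (vekuaPair_onePlusSqPow β) hP (by omega)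
    (k + p) hY
  have hd := (contDiffAt_radialPair (vekuaPair_onePlusSqPow β) hP.1.contDiff (k + p)
    hY).differentiableAt (by simp)
  have h2 (g : E (m + 1) → Cl m) (hg : DifferentiableAt ℝ g Y) :
      cauchyRiemann (fun Z => c • g Z) Y = c • cauchyRiemann g Y := by
    simp only [cauchyRiemann, fderiv_fun_const_smul hg, smul_apply, mul_smul_comm, smul_add,
      Finset.smul_sum]
  rw [h2 _ hd, h1]
  -- The order of differentiation equals N, so the factor n - N is zero.
  simp

theorem Ft_join_zero_of_ne_zero (α β : ℝ) (hP : IsHomogeneousMonogenic k P) (hm : m = 2 * p + 1)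
    (hβ : β = α + (k + p : ℕ)) {x : E m} (hx : x ≠ 0) (hx1 : ‖x‖ < 1) :
    Ft k (onePlusSqPow β) P (join 0 x) = fueterConst m k α • weight α P x := by
  have hX : join 0 x ∈ puncturedCylinder m := ⟨hx, hx1⟩
  have hs := mem_strip hX
  rw [join_zero, vpart_join] at hs
  have hv := vekuaPair_onePlusSqPow β
  have hsq {s : ℝ} (hs : ((0 : ℝ), s) ∈ strip) : onePlusSqPow β ⟨0, √s⟩ = ((1 - s) ^ β : ℝ) := by
    have hs1 : 0 < s := hs.1
    have hs2 : s < 1 := hs.2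
    rw [onePlusSqPow_imag, Real.sq_sqrt hs1.le]
    rw [abs_of_nonneg (Real.sqrt_nonneg s), Real.sqrt_lt' one_pos]
    simpa using hs2
  have h1 := iterate_dsnd_one_sub_rpow hv.analytic_left β (fun s hs => by
    rw [rePart, hsq hs, Complex.ofReal_re]) (k + p) _ hs
  have h2 := iterate_dsnd_eq_zero hv.analytic_right (fun s hs => by
    rw [imPart, hsq hs, Complex.ofReal_im, zero_mul]) (k + p) _ hs
  have e1 : k + (m - 1) / 2 = k + p := by omega
  have e2 : 2 * k + m - 1 = 2 * (k + p) := by omega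
  have e3 : β - (k + p : ℕ) = α := by rw [hβ]; ring
  have e4 : (-2 : ℝ) ^ (k + p) = (-1) ^ (k + p) * 2 ^ (k + p) := by rw [← mul_pow]; norm_num
  have e5 : ∏ i ∈ Finset.range (k + p), (β - i) = ∏ j ∈ Finset.Icc 1 (k + p), (α + (j : ℝ)) := by
    rw [hβ, prod_range_sub_eq_prod_Icc]
  rw [e3, e5] at h1
  rw [Ft_eq_radialPair β hP hm hX, radialPair, join_zero, vpart_join, h1, h2, zero_smul, add_zero,
    weight, smul_smul, smul_smul, fueterConst, e1, e2, e4]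
  congr 1
  ring

theorem continuousAt_weight (α : ℝ) {P : E m → Cl m} (hP : ContDiff ℝ ω P) {x : E m}
    (hx : ‖x‖ < 1) : ContinuousAt (weight α P) x := by
  have h1 : ContinuousAt (fun x : E m => 1 - ‖x‖ ^ 2) x := by fun_prop
  have hx2 : ‖x‖ ^ 2 < 1 := (sq_lt_one_iff₀ (norm_nonneg x)).2 hx
  exact (h1.rpow_const (Or.inl (by linarith))).smul hP.continuous.continuousAt

theorem Ft_join_zero (α : ℝ) (hP : IsHomogeneousMonogenic k P) (hm : m = 2 * p + 1)
    {x : E m} (hx1 : ‖x‖ < 1) :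
    Ft k (onePlusSqPow (α + k + ((m : ℝ) - 1) / 2)) P (join 0 x) =
      fueterConst m k α • weight α P x := by
  have hβ : α + k + ((m : ℝ) - 1) / 2 = α + (k + p : ℕ) := by
    rw [hm]; push_cast; ring
  by_cases hx : x = 0
  · have : NeZero m := ⟨by omega⟩
    subst hx
    have hX : joinL m 0 ∈ cylinder m := hx1
    have h1 : ContinuousAt (fun x : E m =>
        Ft k (onePlusSqPow (α + k + ((m : ℝ) - 1) / 2)) P (joinL m x)) 0 :=
      ContinuousAt.comp (g := Ft k (onePlusSqPow (α + k + ((m : ℝ) - 1) / 2)) P)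
        (contDiffAt_Ft _ hP hX).continuousAt (joinL m).continuous.continuousAt
    have h2 : ContinuousAt (fun x : E m => fueterConst m k α • weight α P x) 0 :=
      (continuousAt_weight α hP.1.contDiff hx1).fun_const_smul _
    -- The radial formula is unavailable at the origin; both sides are continuous there and agree at
    -- nearby x ≠ 0.
    refine tendsto_nhds_unique_of_eventuallyEq (l := 𝓝[≠] (0 : E m))
      (h1.mono_left nhdsWithin_le_nhds) (h2.mono_left nhdsWithin_le_nhds) ?_
    filter_upwards [self_mem_nhdsWithin, nhdsWithin_le_nhds (Metric.ball_mem_nhds 0 one_pos)]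
      with x hx hx'
    exact Ft_join_zero_of_ne_zero α _ hP hm hβ hx (by simpa using hx')
  · exact Ft_join_zero_of_ne_zero α _ hP hm hβ hx hx1

end

/-! ### Iterated Dirac operator and Taylor coefficients in `x_0` -/

theorem dirac_const_smul (c : ℝ) (f : E m → Cl m) (x : E m) :
    dirac (fun y => c • f y) x = c • dirac f x := by
  have h : fderiv ℝ (fun y => c • f y) x = c • fderiv ℝ f x := by
    -- Differentiability of f is not assumed: an invertible scalar passes through `fderiv`
    -- regardless, and for c = 0 both sides vanish.
    rcases eq_or_ne c 0 with rfl | hc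
    · refine ContinuousLinearMap.ext fun v => ?_
      simp
    · have := invertibleOfNonzero hc
      exact fderiv_const_smul_of_invertible c
  simp only [dirac, h, smul_apply, mul_smul_comm, Finset.smul_sum]

theorem iterate_dirac_const_smul (c : ℝ) (n : ℕ) (f : E m → Cl m) :
    dirac^[n] (fun y => c • f y) = fun y => c • dirac^[n] f y := by
  induction n with
  | zero => rfl
  | succ n ih =>
    rw [Function.iterate_succ_apply', ih, Function.iterate_succ_apply']
    funext x
    exact dirac_const_smul c _ x

theorem iterate_dirac_congr {f g : E m → Cl m} {U : Set (E m)} (hU : IsOpen U)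
    (h : ∀ x ∈ U, f x = g x) (n : ℕ) : ∀ x ∈ U, dirac^[n] f x = dirac^[n] g x := by
  induction n with
  | zero => exact h
  | succ n ih =>
    intro x hx
    rw [Function.iterate_succ_apply', Function.iterate_succ_apply']
    exact dirac_congr ((hU.eventually_mem hx).mono ih)

theorem dirac_comp_join {F : E (m + 1) → Cl m} {x : E m}
    (hF : DifferentiableAt ℝ F (join 0 x)) (h0 : cauchyRiemann F (join 0 x) = 0) :
    fderiv ℝ F (join 0 x) (EuclideanSpace.single 0 1) = -dirac (fun y => F (join 0 y)) x := by
  have h1 : HasFDerivAt (fun y => F (join 0 y)) ((fderiv ℝ F (join 0 x)).comp (joinL m)) x :=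
    HasFDerivAt.comp (g := F) x hF.hasFDerivAt (joinL m).hasFDerivAt
  rw [dirac, h1.fderiv]
  simp only [ContinuousLinearMap.comp_apply, joinL_single]
  exact eq_neg_of_add_eq_zero_left h0

theorem cauchyRiemann_fderiv {F : E (m + 1) → Cl m} {X : E (m + 1)} (hF : ContDiffAt ℝ ω F X)
    (h0 : ∀ᶠ Y in 𝓝 X, cauchyRiemann F Y = 0) (v : E (m + 1)) :
    cauchyRiemann (fun Y => fderiv ℝ F Y v) X = 0 := by
  have hs : IsSymmSndFDerivAt ℝ F X := hF.isSymmSndFDerivAt_of_omega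
  have h1 := fderiv_cauchyRiemann hF v
  have h2 : fderiv ℝ (cauchyRiemann F) X = 0 := by
    have : cauchyRiemann F =ᶠ[𝓝 X] fun _ => 0 := h0
    rw [this.fderiv_eq]; simp
  rw [h2] at h1
  simp only [cauchyRiemann, fderiv_fderiv_apply_eq hF]
  rw [hs _ v]
  refine Eq.trans ?_ h1.symm
  congr 1
  exact Finset.sum_congr rfl fun j _ => by rw [hs _ v]

theorem hasDerivAt_comp_join {F : E (m + 1) → Cl m} {t : ℝ} {x : E m}
    (hF : DifferentiableAt ℝ F (join t x)) :
    HasDerivAt (fun t => F (join t x))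
      (fderiv ℝ F (join t x) (EuclideanSpace.single 0 1)) t := by
  have h1 : HasDerivAt (fun t : ℝ => join t x) (EuclideanSpace.single 0 1) t := by
    simp_rw [join_eq]
    simpa using ((hasDerivAt_id t).smul_const
      (EuclideanSpace.single (0 : Fin (m + 1)) (1 : ℝ))).add_const (joinL m x)
  exact HasFDerivAt.comp_hasDerivAt (l := F) t hF.hasFDerivAt h1

/-- The induction runs over all monogenic F at once, because ∂_{x_0} F is again monogenic and
restricts to minus the Dirac derivative of the restriction of F. -/
theorem iteratedDeriv_join_eq_dirac (n : ℕ) {F : E (m + 1) → Cl m}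
    (hF : ∀ X ∈ cylinder m, ContDiffAt ℝ ω F X) (h0 : ∀ X ∈ cylinder m, cauchyRiemann F X = 0)
    {x : E m} (hx : ‖x‖ < 1) :
    iteratedDeriv n (fun t => F (join t x)) 0 =
      (-1 : ℝ) ^ n • dirac^[n] (fun y => F (join 0 y)) x := by
  induction n generalizing F with
  | zero => simp
  | succ n ih =>
    have hd (X : E (m + 1)) (hX : X ∈ cylinder m) : DifferentiableAt ℝ F X :=
      (hF X hX).differentiableAt (by simp)
    have hcyl (t : ℝ) (y : E m) (hy : ‖y‖ < 1) : join t y ∈ cylinder m := hy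
    have h1 : deriv (fun t => F (join t x)) =
        fun t => (fun Y => fderiv ℝ F Y (EuclideanSpace.single 0 1)) (join t x) :=
      funext fun t => (hasDerivAt_comp_join (hd _ (hcyl t x hx))).deriv
    rw [iteratedDeriv_succ', h1, ih
      (fun X hX => ((hF X hX).fderiv_right (m := ω) le_rfl).clm_apply contDiffAt_const)
      (fun X hX => cauchyRiemann_fderiv (hF X hX) ((isOpen_cylinder.eventually_mem hX).mono h0) _),
      iterate_dirac_congr (U := Metric.ball 0 1)
        (g := fun y => (-1 : ℝ) • dirac (fun y => F (join 0 y)) y) Metric.isOpen_ball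
        (fun y hy => ?_) n x (by simpa using hx), iterate_dirac_const_smul, smul_smul, pow_succ,
      Function.iterate_succ_apply]
    have hy' : join 0 y ∈ cylinder m := hcyl 0 y (by simpa using hy)
    rw [dirac_comp_join (hd _ hy') (h0 _ hy'), neg_one_smul]

/-! ### Convergence of Taylor series -/

/-- Real analyticity on an interval does not make the Taylor series at 0 converge there, so
convergence is a hypothesis. Given it, the sum is analytic and agrees with f near 0, hence on the
interval. -/
theorem hasSum_taylor_of_summable {V : Type*} [NormedAddCommGroup V] [NormedSpace ℝ V]
    [CompleteSpace V] {f : ℝ → V} {R : ℝ} (hf : ∀ t, |t| < R → AnalyticAt ℝ f t)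
    (hs : ∀ t, |t| < R → Summable fun n : ℕ => (t ^ n / (n.factorial : ℝ)) • iteratedDeriv n f 0)
    {t : ℝ} (ht : |t| < R) :
    HasSum (fun n : ℕ => (t ^ n / (n.factorial : ℝ)) • iteratedDeriv n f 0) (f t) := by
  have hR : 0 < R := (abs_nonneg t).trans_lt ht
  obtain ⟨p, r₀, hp⟩ := hf 0 (by simpa using hR)
  have hcoef (n : ℕ) : p.coeff n = ((n.factorial : ℝ)⁻¹) • iteratedDeriv n f 0 := by
    have h1 := hp.factorial_smul (1 : ℝ) n
    rw [iteratedDeriv_eq_iteratedFDeriv, ← h1, ← Nat.cast_smul_eq_nsmul ℝ, smul_smul,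
      inv_mul_cancel₀ (by positivity), one_smul]
    rfl
  have hterm (s : ℝ) (n : ℕ) :
      (s ^ n / (n.factorial : ℝ)) • iteratedDeriv n f 0 = s ^ n • p.coeff n := by
    rw [hcoef, smul_smul, div_eq_mul_inv]
  simp_rw [hterm] at hs ⊢
  -- Convergence at the real point r makes its terms tend to 0, which bounds the radius below by r >
  -- |t|.
  obtain ⟨r, htr, hrR⟩ := exists_between ht
  have hr0 : 0 < r := (abs_nonneg t).trans_lt htr
  have hrad : ENNReal.ofReal r ≤ p.radius := by
    have h1 := (hs r (by rwa [abs_of_pos hr0])).tendsto_atTop_zero.norm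
    rw [norm_zero] at h1
    refine p.le_radius_of_tendsto (r := r.toNNReal) (l := 0) (h1.congr fun n => ?_)
    rw [norm_smul, norm_pow, Real.norm_of_nonneg hr0.le, mul_comm, Real.coe_toNNReal _ hr0.le,
      ← p.norm_apply_eq_norm_coef]
  have hsum := p.hasFPowerSeriesOnBall (lt_of_lt_of_le (by simpa using hr0) hrad)
  have hev : f =ᶠ[𝓝 0] p.sum := by
    have h1 := hasFPowerSeriesAt_iff.1 hp.hasFPowerSeriesAt
    have h2 := hasFPowerSeriesAt_iff.1 hsum.hasFPowerSeriesAt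
    filter_upwards [h1, h2] with z h1 h2
    simpa using h1.unique h2
  have hball : ∀ s ∈ Metric.ball (0 : ℝ) r, s ∈ Metric.eball (0 : ℝ) p.radius := by
    intro s hs
    refine Metric.eball_subset_eball hrad ?_
    rwa [Metric.eball_ofReal]
  have heq : Set.EqOn f p.sum (Metric.ball 0 r) := by
    refine AnalyticOnNhd.eqOn_of_preconnected_of_eventuallyEq (fun s hs => hf s ?_)
      (fun s hs => hsum.analyticAt_of_mem (hball s hs)) (convex_ball 0 r).isPreconnected
      (Metric.mem_ball_self hr0) hev
    have : |s| < r := by simpa using hs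
    exact this.trans hrR
  have htm : t ∈ Metric.ball (0 : ℝ) r := by simpa using htr
  rw [heq htm]
  have h3 := hsum.hasSum (hball t htm)
  simpa using h3

/-! ### Power series converging in the unit disk -/

/-- The power series with coefficients `a` converges absolutely in the unit disk. -/
def DiskSummable (a : ℕ → ℝ) : Prop :=
  ∀ ρ : ℝ, 0 ≤ ρ → ρ < 1 → Summable fun n => |a n| * ρ ^ n

/-- The sum of the power series with coefficients `a`. -/
def powerSum (a : ℕ → ℝ) (s : ℝ) : ℝ := ∑' n, a n * s ^ n

theorem DiskSummable.summable {a : ℕ → ℝ} (ha : DiskSummable a) {s : ℝ} (hs : |s| < 1) :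
    Summable fun n => a n * s ^ n :=
  Summable.of_norm (by simpa [abs_mul] using ha |s| (abs_nonneg s) hs)

theorem DiskSummable.succ {a : ℕ → ℝ} (ha : DiskSummable a) :
    DiskSummable fun n => a (n + 1) := by
  intro ρ h0 h1
  obtain ⟨r, hr, hr1⟩ := exists_between h1
  have hr0 : 0 < r := h0.trans_lt hr
  have h2 := ((summable_nat_add_iff 1).2 (ha r hr0.le hr1)).mul_left r⁻¹
  refine Summable.of_nonneg_of_le (fun n => by positivity) (fun n => ?_) h2
  have : r⁻¹ * (|a (n + 1)| * r ^ (n + 1)) = |a (n + 1)| * r ^ n := by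
    rw [pow_succ]; field_simp
  rw [this]
  gcongr

theorem DiskSummable.natCast_mul {a : ℕ → ℝ} (ha : DiskSummable a) :
    DiskSummable fun n => n * a n := by
  intro ρ h0 h1
  obtain ⟨r, hr, hr1⟩ := exists_between h1
  have hr0 : 0 < r := h0.trans_lt hr
  have h2 : Tendsto (fun n : ℕ => (n : ℝ) * (ρ / r) ^ n) atTop (𝓝 0) :=
    tendsto_self_mul_const_pow_of_lt_one (by positivity) ((div_lt_one hr0).2 hr)
  obtain ⟨C, hC⟩ := h2.bddAbove_range
  refine Summable.of_nonneg_of_le (fun n => by positivity) (fun n => ?_)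
    ((ha r hr0.le hr1).mul_left C)
  have h3 : (n : ℝ) * (ρ / r) ^ n ≤ C := hC ⟨n, rfl⟩
  have h4 : |(n : ℝ) * a n| * ρ ^ n = (n * (ρ / r) ^ n) * (|a n| * r ^ n) := by
    rw [abs_mul, Nat.abs_cast, div_pow]
    field_simp
  rw [h4]
  gcongr

theorem DiskSummable.const_mul {a : ℕ → ℝ} (ha : DiskSummable a) (c : ℝ) :
    DiskSummable fun n => c * a n := fun ρ h0 h1 => by
  simpa only [abs_mul, mul_assoc] using (ha ρ h0 h1).mul_left |c|

theorem DiskSummable.add {a b : ℕ → ℝ} (ha : DiskSummable a) (hb : DiskSummable b) :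
    DiskSummable fun n => a n + b n := fun ρ h0 h1 =>
  Summable.of_nonneg_of_le (fun n => by positivity)
    (fun n => by rw [← add_mul]; gcongr; exact abs_add_le _ _) ((ha ρ h0 h1).add (hb ρ h0 h1))

theorem DiskSummable.hasDerivAt {a : ℕ → ℝ} (ha : DiskSummable a) {s : ℝ} (hs : |s| < 1) :
    HasDerivAt (powerSum a) (∑' n : ℕ, a n * (n * s ^ (n - 1))) s := by
  obtain ⟨ρ, hρ, hρ1⟩ := exists_between hs
  have hρ0 : 0 < ρ := (abs_nonneg s).trans_lt hρ
  have hu : Summable fun n : ℕ => |a n| * (n * ρ ^ (n - 1)) := by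
    refine ((ha.natCast_mul ρ hρ0.le hρ1).mul_left ρ⁻¹).congr fun n => ?_
    rcases n with _ | n
    · simp
    · rw [abs_mul, Nat.abs_cast, Nat.add_sub_cancel, pow_succ]
      field_simp
  refine hasDerivAt_tsum_of_isPreconnected (t := Metric.ball 0 ρ) (y₀ := 0) hu Metric.isOpen_ball
    (convex_ball 0 ρ).isPreconnected (fun n y _ => (hasDerivAt_pow n y).const_mul (a n))
    (fun n y hy => ?_) (Metric.mem_ball_self hρ0) (ha.summable (by simp)) (by simpa using hρ)
  have hy' : |y| < ρ := by simpa using hy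
  rw [norm_mul, norm_mul, norm_pow, Real.norm_eq_abs, Real.norm_eq_abs, Real.norm_eq_abs,
    Nat.abs_cast]
  gcongr

theorem DiskSummable.summable_deriv {a : ℕ → ℝ} (ha : DiskSummable a) {s : ℝ} (hs : |s| < 1) :
    Summable fun n : ℕ => ((n : ℝ) + 1) * a (n + 1) * s ^ n := by
  simpa using ha.natCast_mul.succ.summable hs

theorem DiskSummable.hasDerivAt' {a : ℕ → ℝ} (ha : DiskSummable a) {s : ℝ} (hs : |s| < 1) :
    HasDerivAt (powerSum a) (powerSum (fun n => ((n : ℝ) + 1) * a (n + 1)) s) s := by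
  have h := ha.hasDerivAt hs
  have h1 : Summable fun n : ℕ => a n * (n * s ^ (n - 1)) := by
    refine (summable_nat_add_iff 1).1 ((ha.summable_deriv hs).congr fun n => ?_)
    push_cast [Nat.add_sub_cancel]
    ring
  rw [h1.tsum_eq_zero_add] at h
  convert h using 1
  rw [powerSum]
  simp only [Nat.cast_zero, zero_mul, mul_zero, zero_add, Nat.add_sub_cancel, Nat.cast_add,
    Nat.cast_one]
  exact tsum_congr fun n => by ring

theorem DiskSummable.mul_deriv {a : ℕ → ℝ} (ha : DiskSummable a) {s : ℝ} (hs : |s| < 1) :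
    s * powerSum (fun n => ((n : ℝ) + 1) * a (n + 1)) s = powerSum (fun n => n * a n) s := by
  rw [powerSum, powerSum, (ha.natCast_mul.summable hs).tsum_eq_zero_add, ← tsum_mul_left]
  simp only [Nat.cast_zero, zero_mul, zero_add, Nat.cast_add, Nat.cast_one]
  exact tsum_congr fun n => by ring

theorem powerSum_const_mul (c : ℝ) (a : ℕ → ℝ) (s : ℝ) :
    powerSum (fun n => c * a n) s = c * powerSum a s := by
  simp only [powerSum, mul_assoc, tsum_mul_left]

theorem DiskSummable.powerSum_add {a b : ℕ → ℝ} (ha : DiskSummable a) (hb : DiskSummable b)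
    {s : ℝ} (hs : |s| < 1) : powerSum (fun n => a n + b n) s = powerSum a s + powerSum b s := by
  simp only [powerSum, add_mul]
  exact (ha.summable hs).tsum_add (hb.summable hs)

/-! ### Iterated Dirac operator on power series in |x|², with coefficient bounds. -/

/-- The coefficients of the power series `A_n` in `s = |x|²` such that
`∂^n (A_0 P) = A_n P` for even `n` and `∂^n (A_0 P) = A_n x P` for odd `n`. -/
def diracCoeff (N : ℕ) (a : ℕ → ℝ) : ℕ → ℕ → ℝ
  | 0 => a
  | n + 1 => if Even n then fun j : ℕ => 2 * (((j : ℝ) + 1) * diracCoeff N a n (j + 1))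
      else fun j : ℕ => -2 * (j * diracCoeff N a n j) + (-(2 * N + 1)) * diracCoeff N a n j

theorem diracCoeff_succ_of_even {N n : ℕ} {a : ℕ → ℝ} (hn : Even n) :
    diracCoeff N a (n + 1) = fun j : ℕ => 2 * (((j : ℝ) + 1) * diracCoeff N a n (j + 1)) := by
  rw [diracCoeff, if_pos hn]

theorem diracCoeff_succ_of_odd {N n : ℕ} {a : ℕ → ℝ} (hn : ¬ Even n) :
    diracCoeff N a (n + 1) =
      fun j : ℕ => -2 * (j * diracCoeff N a n j) + (-(2 * N + 1)) * diracCoeff N a n j := by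
  rw [diracCoeff, if_neg hn]

theorem DiskSummable.diracCoeff {a : ℕ → ℝ} (ha : DiskSummable a) (N n : ℕ) :
    DiskSummable (diracCoeff N a n) := by
  induction n with
  | zero => exact ha
  | succ n ih =>
    by_cases hn : Even n
    · rw [diracCoeff_succ_of_even hn]
      have h := ih.natCast_mul.succ
      push_cast at h
      exact h.const_mul 2
    · rw [diracCoeff_succ_of_odd hn]
      exact (ih.natCast_mul.const_mul _).add (ih.const_mul _)

/-- The recursion encodes ∂(A P) = 2A' x P and ∂(A x P) = (-2s A' - (2N + 1) A) P, with ' = d/ds. -/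
theorem iterate_dirac_powerSum {k N : ℕ} {P : E m → Cl m} (hP : IsHomogeneousMonogenic k P)
    (hN : 2 * k + m = 2 * N + 1) {a : ℕ → ℝ} (ha : DiskSummable a) (n : ℕ) :
    ∀ x : E m, ‖x‖ < 1 → dirac^[n] (fun y => powerSum a (‖y‖ ^ 2) • P y) x =
      powerSum (diracCoeff N a n) (‖x‖ ^ 2) • (if Even n then P x else vec x * P x) := by
  induction n with
  | zero => intro x _; simp [diracCoeff]
  | succ n ih =>
    intro x hx
    have hs : |‖x‖ ^ 2| < 1 := by
      rw [abs_of_nonneg (by positivity)]; exact (sq_lt_one_iff₀ (norm_nonneg x)).2 hx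
    have hb := ha.diracCoeff N n
    rw [Function.iterate_succ_apply', dirac_congr (((Metric.isOpen_ball (x := (0 : E m))
      (ε := 1)).eventually_mem (by simpa using hx)).mono fun y hy => ih y (by simpa using hy))]
    by_cases hn : Even n
    · simp only [hn, if_true, Nat.even_add_one, not_true_eq_false, if_false]
      rw [dirac_radial_smul (hb.hasDerivAt' hs) (hP.1.contDiff.differentiable (by simp) x), hP.2,
        smul_zero, add_zero, diracCoeff_succ_of_even hn, powerSum_const_mul]
    · simp only [hn, if_false, Nat.even_add_one, not_false_eq_true, if_true]
      rw [dirac_radial_smul (hb.hasDerivAt' hs)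
        ((contDiff_vec_mul hP.1.contDiff).differentiable (by simp) x), hP.dirac_vec_mul,
        vec_mul_vec_mul, diracCoeff_succ_of_odd hn,
        (hb.natCast_mul.const_mul _).powerSum_add (hb.const_mul _) hs, powerSum_const_mul,
        powerSum_const_mul, ← hb.mul_deriv hs]
      have hN' : (2 * k + m : ℝ) = 2 * N + 1 := by exact_mod_cast hN
      rw [hN']
      module

/-- Each coefficient is a single a_J times n factors, where J = j + ⌈n/2⌉ since only steps from even
n shift the index. The factor at step n is 2(j + 1) or 2j + 2N + 1 in absolute value, at most 2J +
2N - n for the index J of the resulting coefficient: the next factor of the descending factorial. -/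
theorem abs_diracCoeff_le (N : ℕ) (a : ℕ → ℝ) (n j : ℕ) :
    |diracCoeff N a n j| ≤
      |a (j + (n + 1) / 2)| * ((2 * (j + (n + 1) / 2) + 2 * N).descFactorial n : ℝ) := by
  induction n generalizing j with
  | zero => simp [diracCoeff]
  | succ n ih =>
    by_cases hn : Even n
    · rw [diracCoeff_succ_of_even hn]
      beta_reduce
      rw [← mul_assoc, abs_mul,
        abs_of_nonneg (by positivity : (0 : ℝ) ≤ 2 * ((j : ℝ) + 1))]
      have h := ih (j + 1)
      have e : j + 1 + (n + 1) / 2 = j + (n + 1 + 1) / 2 := by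
        obtain ⟨i, rfl⟩ := hn; omega
      rw [e] at h
      rw [Nat.descFactorial_succ, Nat.cast_mul, mul_left_comm]
      refine mul_le_mul ?_ h (abs_nonneg _) (by positivity)
      have : 2 * (j + 1) ≤ 2 * (j + (n + 1 + 1) / 2) + 2 * N - n := by
        obtain ⟨i, rfl⟩ := hn; omega
      exact_mod_cast this
    · rw [diracCoeff_succ_of_odd hn]
      have e0 : -2 * (j * diracCoeff N a n j) + (-(2 * N + 1)) * diracCoeff N a n j =
          -(((2 * j + 2 * N + 1 : ℕ) : ℝ) * diracCoeff N a n j) := by push_cast; ring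
      beta_reduce
      rw [e0, abs_neg, abs_mul, Nat.abs_cast]
      have h := ih j
      have e : j + (n + 1) / 2 = j + (n + 1 + 1) / 2 := by
        obtain ⟨i, rfl⟩ := Nat.not_even_iff_odd.1 hn; omega
      rw [e] at h
      rw [Nat.descFactorial_succ, Nat.cast_mul, mul_left_comm]
      refine mul_le_mul ?_ h (abs_nonneg _) (by positivity)
      have : 2 * j + 2 * N + 1 ≤ 2 * (j + (n + 1 + 1) / 2) + 2 * N - n := by
        obtain ⟨i, rfl⟩ := Nat.not_even_iff_odd.1 hn; omega
      exact_mod_cast this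

/-- For fixed J the sum over n is the binomial expansion of (x + ρ)^{2J+2N}; what remains is the
series of |a_J| at (x + ρ)² < 1. This is the source of the region |x_0| + |x| < 1. -/
theorem summable_choose_mul_pow {a : ℕ → ℝ} (ha : DiskSummable a) (N : ℕ) {x ρ : ℝ} (hx : 0 ≤ x)
    (hρ : 0 ≤ ρ) (hlt : x + ρ < 1) :
    Summable fun q : ℕ × ℕ => |a q.1| *
      (x ^ q.2 * ρ ^ (2 * q.1 + 2 * N - q.2) * ((2 * q.1 + 2 * N).choose q.2 : ℝ)) := by
  have hfib (J : ℕ) : HasSum (fun n : ℕ => |a J| *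
      (x ^ n * ρ ^ (2 * J + 2 * N - n) * ((2 * J + 2 * N).choose n : ℝ)))
      (|a J| * (x + ρ) ^ (2 * J + 2 * N)) := by
    rw [add_pow]
    refine (hasSum_sum_of_ne_finset_zero fun n hn => ?_).mul_left _
    rw [Nat.choose_eq_zero_of_lt (by simpa using hn)]
    simp
  refine (summable_prod_of_nonneg fun q => by positivity).2 ⟨fun J => (hfib J).summable, ?_⟩
  simp only [(hfib _).tsum_eq]
  have h1 := (ha ((x + ρ) ^ 2) (by positivity) (by
    rw [sq_lt_one_iff₀ (by positivity)]; exact hlt)).mul_right ((x + ρ) ^ (2 * N))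
  exact h1.congr fun J => by
    rw [mul_assoc, pow_add, pow_mul (x + ρ) 2 J]

/-- Dividing the descending factorial by n! gives a binomial coefficient, and (n, j) ↦ (J, n) is
injective, so the series is dominated by part of the binomial double series. -/
theorem summable_diracCoeff {a : ℕ → ℝ} (ha : DiskSummable a) (N : ℕ) {x ρ : ℝ} (hx : 0 ≤ x)
    (hρ : 0 < ρ) (hlt : x + ρ < 1) :
    Summable fun q : ℕ × ℕ =>
      x ^ q.1 / (q.1.factorial : ℝ) * (|diracCoeff N a q.1 q.2| * (ρ ^ 2) ^ q.2) := by
  have hinj : Function.Injective fun q : ℕ × ℕ => (q.2 + (q.1 + 1) / 2, q.1) := by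
    rintro ⟨n, j⟩ ⟨n', j'⟩ h
    simp only [Prod.mk.injEq] at h ⊢
    obtain ⟨h1, rfl⟩ := h
    exact ⟨rfl, by omega⟩
  have h1 := ((summable_choose_mul_pow ha N hx hρ.le hlt).comp_injective hinj).mul_left
    (ρ ^ (2 * N + 1))⁻¹
  refine Summable.of_nonneg_of_le (fun q => by positivity) ?_ h1
  rintro ⟨n, j⟩
  simp only [Function.comp_apply]
  have h2 := abs_diracCoeff_le N a n j
  set J := j + (n + 1) / 2 with hJ
  rw [Nat.descFactorial_eq_factorial_mul_choose, Nat.cast_mul] at h2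
  -- Here 2J - n is 2j or 2j + 1; the extra 1 in 2N + 1 covers the odd case, using ρ < 1.
  have h3 : (ρ ^ 2) ^ j ≤ (ρ ^ (2 * N + 1))⁻¹ * ρ ^ (2 * J + 2 * N - n) := by
    rw [← div_eq_inv_mul, le_div_iff₀ (by positivity), ← pow_mul, ← pow_add]
    exact pow_le_pow_of_le_one hρ.le (by linarith) (by omega)
  calc x ^ n / (n.factorial : ℝ) * (|diracCoeff N a n j| * (ρ ^ 2) ^ j)
      ≤ x ^ n / (n.factorial : ℝ) * ((|a J| * (n.factorial * ((2 * J + 2 * N).choose n : ℝ))) *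
        ((ρ ^ (2 * N + 1))⁻¹ * ρ ^ (2 * J + 2 * N - n))) := by gcongr
    _ = _ := by field_simp

/-! ### Convergence of the CK series and its identification with the Fueter transform. -/

theorem exists_powerSum_one_sub_rpow (α : ℝ) : ∃ a : ℕ → ℝ, DiskSummable a ∧
    ∀ s : ℝ, |s| < 1 → (1 - s) ^ α = powerSum a s := by
  have h := Real.one_add_rpow_hasFPowerSeriesOnBall_zero (a := α)
  refine ⟨fun n => (-1) ^ n * Ring.choose α n, fun ρ h0 h1 => ?_, fun s hs => ?_⟩
  · lift ρ to NNReal using h0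
    have h2 := (binomialSeries ℝ α).summable_norm_mul_pow (r := ρ)
      (lt_of_lt_of_le (by exact_mod_cast h1) h.r_le)
    refine h2.congr fun n => ?_
    rw [binomialSeries, FormalMultilinearSeries.ofScalars_norm, abs_mul, abs_pow, abs_neg, abs_one,
      one_pow, one_mul, Real.norm_eq_abs]
  · have hm : -s ∈ Metric.eball (0 : ℝ) 1 := by
      rw [← ENNReal.ofReal_one, Metric.eball_ofReal]
      simpa using hs
    have h2 := h.hasSum hm
    rw [zero_add, ← sub_eq_add_neg] at h2
    rw [powerSum, ← h2.tsum_eq]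
    refine tsum_congr fun n => ?_
    rw [binomialSeries, FormalMultilinearSeries.ofScalars_apply_eq, smul_eq_mul, neg_pow]
    ring

/-- Proved directly from the coefficients rather than read off from the Fueter transform, since c
vanishes for some α. -/
theorem summable_ckTerm_weight {k N : ℕ} {P : E m → Cl m} (hP : IsHomogeneousMonogenic k P)
    (hN : 2 * k + m = 2 * N + 1) (α : ℝ) {X : E (m + 1)} (hX : |X 0| + ‖vpart X‖ < 1) :
    Summable (ckTerm (weight α P) X) := by
  obtain ⟨a, ha, hpow⟩ := exists_powerSum_one_sub_rpow α
  -- ρ stands in for |x|, which may be 0, while the majorant divides by a power of ρ.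
  obtain ⟨ρ, hρ1, hρ2⟩ := exists_between (show ‖vpart X‖ < 1 - |X 0| by linarith)
  have hρ0 : 0 < ρ := (norm_nonneg _).trans_lt hρ1
  have hx1 : ‖vpart X‖ < 1 := by linarith [abs_nonneg (X 0)]
  have hd (n : ℕ) : dirac^[n] (weight α P) (vpart X) =
      powerSum (diracCoeff N a n) (‖vpart X‖ ^ 2) •
        (if Even n then P (vpart X) else vec (vpart X) * P (vpart X)) := by
    rw [← iterate_dirac_powerSum hP hN ha n _ hx1]
    refine iterate_dirac_congr (U := Metric.ball 0 1) Metric.isOpen_ball (fun y hy => ?_) n _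
      (by simpa using hx1)
    have hy' : ‖y‖ < 1 := by simpa using hy
    rw [weight, hpow]
    rw [abs_of_nonneg (by positivity)]
    exact (sq_lt_one_iff₀ (norm_nonneg y)).2 hy'
  set C := max ‖P (vpart X)‖ ‖vec (vpart X) * P (vpart X)‖
  have hsum := (summable_diracCoeff ha N (abs_nonneg (X 0)) hρ0 (by linarith)).prod.mul_right C
  refine Summable.of_norm_bounded hsum fun n => ?_
  dsimp only
  rw [ckTerm, hd, norm_smul, norm_smul, tsum_mul_left, ← mul_assoc, norm_div, norm_pow, norm_neg,
    RCLike.norm_natCast, Real.norm_eq_abs]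
  have hC : ‖(if Even n then P (vpart X) else vec (vpart X) * P (vpart X))‖ ≤ C := by
    split_ifs
    · exact le_max_left _ _
    · exact le_max_right _ _
  have hb : ‖powerSum (diracCoeff N a n) (‖vpart X‖ ^ 2)‖ ≤
      ∑' j, |diracCoeff N a n j| * (ρ ^ 2) ^ j := by
    refine tsum_of_norm_bounded (ha.diracCoeff N n (ρ ^ 2) (by positivity) ?_).hasSum fun j => ?_
    · rw [sq_lt_one_iff₀ hρ0.le]; linarith [abs_nonneg (X 0)]
    · rw [norm_mul, norm_pow, norm_pow, norm_norm, Real.norm_eq_abs]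
      gcongr
  gcongr

theorem Ft_eq_smul_CK {k p : ℕ} {P : E m → Cl m} (hP : IsHomogeneousMonogenic k P)
    (hm : m = 2 * p + 1) (α : ℝ) {X : E (m + 1)} (hX : |X 0| + ‖vpart X‖ < 1) :
    Ft k (onePlusSqPow (α + k + ((m : ℝ) - 1) / 2)) P X =
      fueterConst m k α • CK (weight α P) X := by
  set F := Ft k (onePlusSqPow (α + k + ((m : ℝ) - 1) / 2)) P with hF
  set c := fueterConst m k α
  set x := vpart X with hx
  have hx1 : ‖x‖ < 1 := by linarith [abs_nonneg (X 0)]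
  have hFd : ∀ Y ∈ cylinder m, ContDiffAt ℝ ω F Y := fun Y hY => contDiffAt_Ft _ hP hY
  have hN : 2 * k + m = 2 * (k + p) + 1 := by omega
  have hcoef (n : ℕ) : iteratedDeriv n (fun t => F (join t x)) 0 =
      ((-1 : ℝ) ^ n * c) • dirac^[n] (weight α P) x := by
    rw [iteratedDeriv_join_eq_dirac n hFd (fun Y hY => cauchyRiemann_Ft _ hP hm hY) hx1,
      iterate_dirac_congr (U := Metric.ball 0 1) (g := fun y => c • weight α P y)
        Metric.isOpen_ball (fun y hy => Ft_join_zero α hP hm (by simpa using hy)) n x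
        (by simpa using hx1), iterate_dirac_const_smul, smul_smul]
  have hterm (t : ℝ) (n : ℕ) :
      (t ^ n / (n.factorial : ℝ)) • iteratedDeriv n (fun t => F (join t x)) 0 =
        c • ckTerm (weight α P) (join t x) n := by
    rw [hcoef, ckTerm, smul_smul, smul_smul, vpart_join, join_zero, neg_pow t]
    congr 1
    ring
  -- The line through x parallel to the x_0-axis stays in the cylinder, so F is analytic along all
  -- of it.
  have han (t : ℝ) : AnalyticAt ℝ (fun t => F (join t x)) t := by
    have h1 : ContDiff ℝ ω fun t : ℝ => join t x := by
      simp_rw [join_eq]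
      fun_prop
    have h2 : join t x ∈ cylinder m := by rwa [cylinder, Set.mem_ofPred_eq, vpart_join]
    exact (ContDiffAt.comp (g := F) (f := fun t => join t x) t (hFd _ h2) h1.contDiffAt).analyticAt
  have hsum (t : ℝ) (ht : |t| < 1 - ‖x‖) : Summable fun n : ℕ =>
      (t ^ n / (n.factorial : ℝ)) • iteratedDeriv n (fun t => F (join t x)) 0 := by
    simp_rw [hterm]
    refine (summable_ckTerm_weight (X := join t x) hP hN α ?_).const_smul c
    rw [vpart_join, join_zero]
    linarith
  have h := hasSum_taylor_of_summable (fun t _ => han t) hsum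
    (show |X 0| < 1 - ‖x‖ by linarith)
  simp_rw [hterm] at h
  rw [hx, join_self] at h
  rw [CK, ← (summable_ckTerm_weight hP hN α hX).tsum_const_smul c]
  exact h.tsum_eq.symm

end CliffordFueter

end

theorem mainTheorem2 (m : ℕ) (hm : Odd m) (k : ℕ) (α : ℝ)
    (P : CliffordFueter.E m → CliffordFueter.Cl m)
    (hP : CliffordFueter.IsHomogeneousMonogenic k P) :
    (∀ X : CliffordFueter.E (m + 1), |X 0| + ‖CliffordFueter.vpart X‖ < 1 →
      Summable (CliffordFueter.ckTerm (CliffordFueter.weight α P) X) ∧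
      CliffordFueter.Ft k
          (CliffordFueter.onePlusSqPow (α + (k : ℝ) + ((m : ℝ) - 1) / 2)) P X =
        CliffordFueter.fueterConst m k α •
          CliffordFueter.CK (CliffordFueter.weight α P) X) ∧
    CliffordFueter.IsMonogenicExtension
      (fun x => CliffordFueter.fueterConst m k α • CliffordFueter.weight α P x)
      (Metric.ball 0 1)
      (CliffordFueter.Ft k
        (CliffordFueter.onePlusSqPow (α + (k : ℝ) + ((m : ℝ) - 1) / 2)) P)
      {X : CliffordFueter.E (m + 1) | ‖CliffordFueter.vpart X‖ < 1} := by
  obtain ⟨p, hp⟩ := hm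
  refine ⟨fun X hX => ⟨CliffordFueter.summable_ckTerm_weight (N := k + p) hP (by omega) α hX,
    CliffordFueter.Ft_eq_smul_CK hP hp α hX⟩, ⟨fun X hX => ?_, fun X hX => ?_⟩, fun X h0 hX => ?_⟩
  · exact ((CliffordFueter.contDiffAt_Ft _ hP hX).of_le le_top).contDiffWithinAt
  · exact CliffordFueter.cauchyRiemann_Ft _ hP hp hX
  · have hX' : ‖CliffordFueter.vpart X‖ < 1 := by simpa using hX
    refine ⟨hX', ?_⟩
    have h := CliffordFueter.Ft_join_zero α hP hp hX'
    rwa [← h0, CliffordFueter.join_self] at h
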